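/- Let $\mathbb{D}$ be the open unit disc, $\mathbb{T}$ the unit circle and $m$ normalized Lebesgue measure on $\mathbb{T}$. For $1\le p<\infty$ let $H^p$ be the Hardy space, identified with the space of all $f\in L^p(\mathbb{T},m)$ whose Fourier coefficients of negative index vanish. Let $\Theta$ be an inner function, that is, a bounded analytic function on $\mathbb{D}$ whose radial limits exist and have modulus one at $m$-almost every point of $\mathbb{T}$; its boundary function is also denoted by $\Theta$. Put \[ K^p_\Theta=H^p\cap\Theta\,\overline{zH^p},\qquad K_\Theta=K^2_\Theta,\qquad \rho(\Theta)=\Bigl\{\zeta\in\mathbb{T}:\ \liminf_{\lambda\to\zeta,\ \lambda\in\mathbb{D}}|\Theta(\lambda)|=0\Bigr\}, \] and let $P_\Theta$ be the orthogonal projection of $L^2(\mathbb{T},m)$ onto $K_\Theta$. Let $\mathcal{V}_p(\Theta)$ be the set of all complex Borel measures $\mu$ on $\mathbb{T}$ for which the embedding $K^p_\Theta\hookrightarrow L^p(|\mu|)$ is (well defined, bounded and) compact, where $|\mu|$ is the total variation of $\mu$. For $\phi\in L^2(\mathbb{T},m)$ the truncated Toeplitz operator $A_\phi$ is the operator in $K_\Theta$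 with domain $K_\Theta\cap H^\infty$ given by $A_\phi f=P_\Theta(\phi f)$. Proposition. Let $\phi:\mathbb{T}\to\mathbb{C}$ be continuous with $\phi(\zeta)=0$ for all $\zeta\in\rho(\Theta)$. Then the complex measure $\phi\,dm$ belongs to $\mathcal{V}_p(\Theta)$ for every $1\le p<\infty$. In particular, $A_\phi$ is compact: its domain is dense in $K_\Theta$ and $A_\phi$ extends to a compact operator on $K_\Theta$. -/

import Mathlib

open MeasureTheory Filter Topology Real
open scoped ENNReal ComplexConjugate InnerProductSpace

noncomputable section

namespace TTO

/-- The unit circle, parametrized by the angle `t` modulo `2π`; the point of the circle in the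
complex plane with angle `t` is `pt t = exp (i t)`. -/
abbrev Torus : Type := AddCircle (2 * π)

instance : Fact (0 < 2 * π) := ⟨by positivity⟩

/-- The point `exp (i t)` of the unit circle in the complex plane. -/
def pt (t : Torus) : ℂ := (AddCircle.toCircle t : ℂ)

/-- Normalized Lebesgue measure `dt / 2π` on the unit circle. -/
abbrev m : Measure Torus := AddCircle.haarAddCircle

/-- The Hardy space `H^p`, identified with the subspace of those functions in `L^p` of the circle
whose Fourier coefficients of negative index vanish. -/
def hardy (p : ℝ≥0∞) [Fact (1 ≤ p)] : Submodule ℂ (Lp ℂ p m) where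
  carrier := {f | ∀ n : ℤ, n < 0 → fourierCoeff (f : Torus → ℂ) n = 0}
  zero_mem' := by
    intro n _
    rw [fourierCoeff, integral_congr_ae (g := fun _ => (0 : ℂ)), integral_zero]
    filter_upwards [Lp.coeFn_zero ℂ p m] with t ht
    simp
  add_mem' := by
    intro f g hf hg n hn
    have hi : ∀ u : Lp ℂ p m, Integrable (fun t => fourier (-n) t • (u : Torus → ℂ) t) m := by
      intro u
      have hu : Integrable (u : Torus → ℂ) m := (Lp.memLp u).integrable Fact.out
      refine hu.bdd_mul (c := 1) (map_continuous (fourier (-n))).aestronglyMeasurable ?_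
      exact Eventually.of_forall fun t => (Circle.norm_coe _).le
    have h := hf n hn
    have h' := hg n hn
    rw [fourierCoeff] at h h' ⊢
    rw [integral_congr_ae (g := fun t => fourier (-n) t • (f : Torus → ℂ) t +
      fourier (-n) t • (g : Torus → ℂ) t), integral_add (hi f) (hi g), h, h', add_zero]
    filter_upwards [Lp.coeFn_add f g] with t ht
    simp only [ht, Pi.add_apply, smul_add]
  smul_mem' := by
    intro c f hf n hn
    have h := hf n hn
    rw [fourierCoeff] at h ⊢
    rw [integral_congr_ae (g := fun t => c • (fourier (-n) t • (f : Torus → ℂ) t)),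
      integral_smul, h, smul_zero]
    filter_upwards [Lp.coeFn_smul c f] with t ht
    simp only [ht, Pi.smul_apply, smul_eq_mul]
    ring

/-- Inner functions: bounded analytic functions on the open unit disc which have radial limits of
modulus one at almost every point of the unit circle. Values off the open disc are irrelevant. -/
structure InnerFunction where
  toFun : ℂ → ℂ
  analytic : DifferentiableOn ℂ toFun (Metric.ball 0 1)
  bounded : ∃ C : ℝ, ∀ z ∈ Metric.ball (0 : ℂ) 1, ‖toFun z‖ ≤ C
  radial : ∀ᵐ t ∂m, ∃ c : ℂ, ‖c‖ = 1 ∧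
    Tendsto (fun r : ℝ => toFun ((r : ℂ) * pt t)) (𝓝[<] 1) (𝓝 c)

namespace InnerFunction

variable (Θ : InnerFunction)

/-- The boundary function of an inner function on the unit circle (its radial limits). -/
def bdry (t : Torus) : ℂ := limUnder (𝓝[<] (1 : ℝ)) fun r : ℝ => Θ.toFun ((r : ℂ) * pt t)

/-- The spectrum of an inner function, a subset of the closed unit disc. -/
def spec : Set ℂ :=
  {ζ | ζ ∈ Metric.closedBall (0 : ℂ) 1 ∧
    liminf (fun z : ℂ => ‖Θ.toFun z‖) (𝓝[Metric.ball 0 1] ζ) = 0}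

/-- The part of the spectrum lying on the unit circle (as a set of angles). -/
def rho : Set Torus := {t | pt t ∈ Θ.spec}

/-- The model space `K^p_Θ = H^p ∩ Θ · conj (z H^p)`. -/
def model (p : ℝ≥0∞) [Fact (1 ≤ p)] : Submodule ℂ (Lp ℂ p m) where
  carrier := {f | f ∈ hardy p ∧ ∃ g ∈ hardy p,
    (f : Torus → ℂ) =ᵐ[m] fun t => Θ.bdry t * conj (pt t * (g : Torus → ℂ) t)}
  zero_mem' := by
    refine ⟨zero_mem _, 0, zero_mem _, ?_⟩
    filter_upwards [Lp.coeFn_zero ℂ p m] with t ht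
    simp
  add_mem' := by
    rintro f f' ⟨hf, g, hg, h⟩ ⟨hf', g', hg', h'⟩
    refine ⟨add_mem hf hf', g + g', add_mem hg hg', ?_⟩
    filter_upwards [h, h', Lp.coeFn_add f f', Lp.coeFn_add g g'] with t h1 h2 h3 h4
    simp only [h3, h4, Pi.add_apply, h1, h2, map_mul, map_add]
    ring
  smul_mem' := by
    rintro c f ⟨hf, g, hg, h⟩
    refine ⟨Submodule.smul_mem _ c hf, conj c • g, Submodule.smul_mem _ _ hg, ?_⟩
    filter_upwards [h, Lp.coeFn_smul c f, Lp.coeFn_smul (conj c) g] with t h1 h2 h3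
    simp only [h2, h3, Pi.smul_apply, smul_eq_mul, h1, map_mul, Complex.conj_conj]
    ring

theorem norm_bdry : ∀ᵐ t ∂m, ‖Θ.bdry t‖ = 1 := by
  filter_upwards [Θ.radial] with t ⟨c, hc, h⟩
  rw [bdry, h.limUnder_eq, hc]

theorem continuous_pt : Continuous pt :=
  continuous_subtype_val.comp AddCircle.continuous_toCircle

theorem norm_pt (t : Torus) : ‖pt t‖ = 1 := Circle.norm_coe _

theorem aestronglyMeasurable_bdry : AEStronglyMeasurable Θ.bdry m := by
  obtain ⟨u, -, hu, hl⟩ := exists_seq_strictMono_tendsto' (show (0 : ℝ) < 1 by norm_num)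
  refine aestronglyMeasurable_of_tendsto_ae atTop
    (f := fun n t => Θ.toFun ((u n : ℂ) * pt t)) (fun n => ?_) ?_
  · refine Continuous.aestronglyMeasurable ?_
    refine Θ.analytic.continuousOn.comp_continuous
      (continuous_const.mul continuous_pt) fun t => ?_
    simp [norm_pt, abs_of_pos (hu n).1, (hu n).2]
  · filter_upwards [Θ.radial] with t ⟨c, hc, h⟩
    rw [bdry, h.limUnder_eq]
    exact h.comp (tendsto_nhdsWithin_iff.2 ⟨hl, Eventually.of_forall fun n => (hu n).2⟩)

theorem memLp_mul_of_norm_le {p : ℝ≥0∞} {b f : Torus → ℂ} (hb : AEStronglyMeasurable b m)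
    (h : ∀ᵐ t ∂m, ‖b t‖ ≤ 1) (hf : MemLp f p m) : MemLp (fun t => b t * f t) p m := by
  refine hf.of_le (hb.mul hf.1) ?_
  filter_upwards [h] with t ht
  rw [norm_mul]
  exact mul_le_of_le_one_left (norm_nonneg _) ht

theorem isClosed_model_two : IsClosed (Θ.model 2 : Set (Lp ℂ 2 m)) := by
  have hw : ∀ k : ℤ, MemLp (fun t : Torus => fourier k t * Θ.bdry t) 2 m := by
    intro k
    refine memLp_mul_of_norm_le (map_continuous (fourier k)).aestronglyMeasurable
      (Eventually.of_forall fun t => (Circle.norm_coe _).le) ?_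
    refine (memLp_const (1 : ℂ)).of_le Θ.aestronglyMeasurable_bdry ?_
    filter_upwards [Θ.norm_bdry] with t ht
    simp [ht]
  have hco : ∀ (u v : Lp ℂ 2 m) (n k : ℤ), n + k = -1 →
      ((u : Torus → ℂ) =ᵐ[m] fun t => Θ.bdry t * conj (pt t * (v : Torus → ℂ) t)) →
      ⟪(hw k).toLp, u⟫_ℂ = conj (fourierCoeff (v : Torus → ℂ) n) := by
    intro u v n k hnk huv
    rw [L2.inner_def, fourierCoeff, ← integral_conj]
    refine integral_congr_ae ?_
    filter_upwards [huv, (hw k).coeFn_toLp, Θ.norm_bdry] with t h1 h2 h3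
    have h4 : conj (Θ.bdry t) * Θ.bdry t = 1 := by
      rw [mul_comm, Complex.mul_conj, Complex.normSq_eq_norm_sq, h3]; simp
    have h5 : (fourier (-n) t : ℂ) = fourier k t * pt t := by
      have : -n = k + 1 := by omega
      rw [this, fourier_add]
      simp [pt, fourier_apply]
    simp only [h1, h2, h5, RCLike.inner_apply, map_mul, smul_eq_mul]
    linear_combination (conj (fourier k t) * conj (pt t) * conj ((v : Torus → ℂ) t)) * h4
  have key : (Θ.model 2 : Set (Lp ℂ 2 m)) =
      {f | ∀ n : ℤ, n < 0 → ⟪fourierBasis (T := 2 * π) n, f⟫_ℂ = 0} ∩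
      {f | ∀ k : ℤ, 0 ≤ k → ⟪(hw k).toLp, f⟫_ℂ = 0} := by
    have hb : ∀ (f : Lp ℂ 2 m) (n : ℤ),
        ⟪fourierBasis (T := 2 * π) n, f⟫_ℂ = fourierCoeff (f : Torus → ℂ) n := by
      intro f n
      rw [← fourierBasis_repr, HilbertBasis.repr_apply_apply]
    ext f
    simp only [Set.mem_inter_iff, Set.mem_ofPred_eq, hb]
    constructor
    · rintro ⟨hf, g, hg, h⟩
      refine ⟨hf, fun k hk => ?_⟩
      rw [hco f g (-1 - k) k (by ring) h, hg _ (by omega), map_zero]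
    · rintro ⟨hf, h⟩
      have hgm : MemLp (fun t => (conj (pt t) * Θ.bdry t) * conj ((f : Torus → ℂ) t)) 2 m := by
        refine memLp_mul_of_norm_le ?_ ?_ (Lp.memLp f).star
        · exact ((Complex.continuous_conj.comp continuous_pt).aestronglyMeasurable).mul
            Θ.aestronglyMeasurable_bdry
        · filter_upwards [Θ.norm_bdry] with t ht
          simp [ht, norm_pt]
      have hfg : (f : Torus → ℂ) =ᵐ[m]
          fun t => Θ.bdry t * conj (pt t * (hgm.toLp : Torus → ℂ) t) := by
        filter_upwards [hgm.coeFn_toLp, Θ.norm_bdry] with t h1 h2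
        have h3 : Θ.bdry t * conj (Θ.bdry t) = 1 := by
          rw [Complex.mul_conj, Complex.normSq_eq_norm_sq, h2]; simp
        have h4 : pt t * conj (pt t) = 1 := by
          rw [Complex.mul_conj, Complex.normSq_eq_norm_sq, norm_pt]; simp
        simp only [h1, map_mul, Complex.conj_conj]
        linear_combination (-(f : Torus → ℂ) t) * (pt t * conj (pt t) * h3 + h4)
      refine ⟨hf, hgm.toLp, fun n hn => ?_, hfg⟩
      have h1 := hco f hgm.toLp n (-1 - n) (by ring) hfg
      rw [h _ (by omega)] at h1
      simpa using h1.symm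
  rw [key]
  simp only [Set.ofPred_forall]
  refine IsClosed.inter ?_ ?_ <;>
  exact isClosed_iInter fun n => isClosed_iInter fun _ =>
    isClosed_eq (continuous_const.inner continuous_id) continuous_const

instance : CompleteSpace (Θ.model 2) := Θ.isClosed_model_two.completeSpace_coe

/-- The orthogonal projection `P_Θ` of `L²` onto `K_Θ = K²_Θ`. -/
def proj : Lp ℂ 2 m →L[ℂ] Θ.model 2 := (Θ.model 2).orthogonalProjectionOnto

/-- `ι` is the embedding of `K^p_Θ` into `L^p(ν)`, for a measure `ν` on the circle.

Elements of `K^p_Θ` are defined `m`-almost everywhere. The embedding keeps these values: `ι f = f`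
almost everywhere for each measure below `ν` which is absolutely continuous with respect to `m`
(if `ν` itself is absolutely continuous, this just says `ι f = f` `ν`-almost everywhere). To cover
measures with a singular part, it is also required, as usual, that `ι` sends each function in
`K^p_Θ` that is continuous on the circle to the same function, `ν`-almost everywhere. -/
structure IsEmbedding (p : ℝ≥0∞) [Fact (1 ≤ p)] (ν : Measure Torus)
    (ι : Θ.model p →L[ℂ] Lp ℂ p ν) : Prop where
  ae_eq : ∀ (f : Θ.model p) (ν' : Measure Torus), ν' ≤ ν → ν' ≪ m →
    (ι f : Torus → ℂ) =ᵐ[ν'] ((f : Lp ℂ p m) : Torus → ℂ)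
  ae_eq_of_continuous : ∀ (f : Θ.model p) (g : C(Torus, ℂ)),
    ((f : Lp ℂ p m) : Torus → ℂ) =ᵐ[m] g → (ι f : Torus → ℂ) =ᵐ[ν] g

/-- The class `V_p(Θ)` of the complex measures `μ` on the circle for which the embedding of
`K^p_Θ` into `L^p(|μ|)` is compact, where `|μ|` is the total variation of `μ`. -/
def classV (p : ℝ≥0∞) [Fact (1 ≤ p)] : Set (ComplexMeasure Torus) :=
  {μ | ∃ ι : Θ.model p →L[ℂ] Lp ℂ p μ.variation,
    Θ.IsEmbedding p μ.variation ι ∧ IsCompactOperator ι}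

/-- `K_Θ ∩ H^∞`: the essentially bounded elements of `K_Θ`. -/
def modelBdd : Submodule ℂ (Θ.model 2) where
  carrier := {f | MemLp ((f : Lp ℂ 2 m) : Torus → ℂ) ∞ m}
  zero_mem' := by
    refine MemLp.ae_eq (f := fun _ => (0 : ℂ)) ?_ MemLp.zero'
    filter_upwards [Lp.coeFn_zero ℂ 2 m] with t ht
    exact ht.symm
  add_mem' := by
    intro f g hf hg
    exact (MemLp.add hf hg).ae_eq (Lp.coeFn_add (f : Lp ℂ 2 m) (g : Lp ℂ 2 m)).symm
  smul_mem' := by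
    intro c f hf
    exact (MemLp.const_smul hf c).ae_eq (Lp.coeFn_smul c (f : Lp ℂ 2 m)).symm

theorem memLp_mul_modelBdd (φ : Lp ℂ 2 m) (f : Θ.modelBdd) :
    MemLp (fun t => (φ : Torus → ℂ) t * (((f : Θ.model 2) : Lp ℂ 2 m) : Torus → ℂ) t) 2 m :=
  MemLp.mul (p := 2) (q := ∞) (r := 2) f.2 (Lp.memLp φ)

/-- The product `φ f`, which is in `L²` for `φ ∈ L²` and `f ∈ K_Θ ∩ H^∞`. -/
def mulSymbol (φ : Lp ℂ 2 m) : Θ.modelBdd →ₗ[ℂ] Lp ℂ 2 m where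
  toFun f := (Θ.memLp_mul_modelBdd φ f).toLp
  map_add' f g := by
    rw [← MemLp.toLp_add]
    refine MemLp.toLp_congr _ _ ?_
    filter_upwards [Lp.coeFn_add ((f : Θ.model 2) : Lp ℂ 2 m) ((g : Θ.model 2) : Lp ℂ 2 m)]
      with t ht
    simp only [Submodule.coe_add, ht, Pi.add_apply, mul_add]
  map_smul' c f := by
    rw [RingHom.id_apply, ← MemLp.toLp_const_smul]
    refine MemLp.toLp_congr _ _ ?_
    filter_upwards [Lp.coeFn_smul c ((f : Θ.model 2) : Lp ℂ 2 m)] with t ht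
    simp only [Submodule.coe_smul, ht, Pi.smul_apply, smul_eq_mul]
    ring

/-- The truncated Toeplitz operator `A_φ` with symbol `φ ∈ L²`: the operator in `K_Θ` with domain
`K_Θ ∩ H^∞`, acting by `A_φ f = P_Θ (φ f)`. -/
def truncatedToeplitz (φ : Lp ℂ 2 m) : Θ.model 2 →ₗ.[ℂ] Θ.model 2 where
  domain := Θ.modelBdd
  toFun := (Θ.proj : Lp ℂ 2 m →ₗ[ℂ] Θ.model 2) ∘ₗ Θ.mulSymbol φ

end InnerFunction

end TTO

end

noncomputable section

namespace TTO

open InnerFunction (continuous_pt norm_pt)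

/-! Near a point x₀ outside ρ(Θ) the modulus of Θ is bounded below, so 1/Θ is bounded and analytic
in the disc near x₀. Let ψ be a smooth bump at x₀ and f = Θ conj(z g) an element of K^p_Θ. On the
circle ψ conj(Θ) f is at once ψ·(f/Θ), where f/Θ is analytic near the arc inside the disc, and
ψ·conj(z g), where g is in H^p. The integral of ψ z^N F, with F analytic near the arc, can be moved
into the disc, where z^N is small; two applications of Green's formula make it O(N⁻²)
(`exists_norm_integral_bump_mul_le`). The first form treats the Fourier coefficients of negative
index, the second the others.

Thus the coefficients of ψ conj(Θ) f are bounded by a summable sequence times ‖f‖, and f ↦ ψ conj(Θ)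
f is a norm convergent series of operators of rank at most one, hence compact; multiplying by Θ, so
is f ↦ ψ f (`isCompactOperator_mulC_bump`). The continuous h with f ↦ h f compact form a closed
ideal of C(𝕋), which consists of all continuous functions vanishing on its common zero set. The
bumps show that this set lies in ρ(Θ), so every h vanishing on ρ(Θ) qualifies
(`isCompactOperator_mulC`).

With h = |φ|^{1/p}, followed by the contraction |φ|^{-1/p} from L^p(m) to L^p(|φ| dm), this gives
the embedding; with h = φ, followed by P_Θ, it gives the extension of A_φ. The domain is dense
because the projections of the monomials z^n to K_Θ are bounded functions, and pairing with them
recovers the Fourier coefficients. -/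

/-! ### Green's formula on a rectangle and decay of oscillatory integrals. -/

theorem integral_sub_integral_eq_of_differentiableAt {a b s s₀ : ℝ} (hab : a ≤ b) (hs : s ≤ s₀)
    {ψ ψ' : ℝ → ℂ} {W : ℂ → ℂ} (hψ : ∀ t, HasDerivAt ψ (ψ' t) t) (hψ' : Continuous ψ')
    (ha : ψ a = 0) (hb : ψ b = 0)
    (hW : ∀ t ∈ Set.Icc a b, ∀ σ ∈ Set.Icc s s₀, DifferentiableAt ℂ W (t + σ * Complex.I)) :
    (∫ t in a..b, ψ t * W (t + s * Complex.I)) - (∫ t in a..b, ψ t * W (t + s₀ * Complex.I)) =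
      Complex.I * ∫ σ in s..s₀, ∫ t in a..b, ψ' t * W (t + σ * Complex.I) := by
  set z : ℂ := ⟨a, s⟩ with hz
  set w : ℂ := ⟨b, s₀⟩ with hw
  -- ψ is extended to be constant in the vertical direction. As W is analytic, the ∂̄-derivative of
  -- the product only sees ψ', and the vertical sides vanish with ψ at the endpoints.
  set f : ℂ → ℂ := fun x => ψ x.re * W x with hf
  have hWx : ∀ x ∈ Set.uIcc z.re w.re ×ℂ Set.uIcc z.im w.im, DifferentiableAt ℂ W x := by
    intro x hx
    rw [Complex.mem_reProdIm] at hx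
    simp only [hz, hw, Set.uIcc_of_le hab, Set.uIcc_of_le hs] at hx
    simpa [Complex.re_add_im] using hW _ hx.1 _ hx.2
  have hder : ∀ x ∈ Set.uIcc z.re w.re ×ℂ Set.uIcc z.im w.im, HasFDerivAt f
      (ψ x.re • ((fderiv ℂ W x).restrictScalars ℝ) +
        W x • (Complex.reCLM.smulRight (ψ' x.re))) x := by
    intro x hx
    have h1 : HasFDerivAt (fun y : ℂ => ψ y.re) (Complex.reCLM.smulRight (ψ' x.re)) x := by
      have := (hψ x.re).hasFDerivAt.comp x Complex.reCLM.hasFDerivAt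
      refine this.congr_fderiv ?_
      ext
      simp
    exact h1.mul ((hWx x hx).hasFDerivAt.restrictScalars ℝ)
  have hlin : ∀ x ∈ Set.uIcc z.re w.re ×ℂ Set.uIcc z.im w.im,
      Complex.I • fderiv ℝ f x 1 - fderiv ℝ f x Complex.I = Complex.I * (ψ' x.re * W x) := by
    intro x hx
    rw [(hder x hx).fderiv]
    have : fderiv ℂ W x Complex.I = Complex.I * fderiv ℂ W x 1 := by
      rw [← smul_eq_mul, ← map_smul]; simp
    simp [this]
    ring
  have hcW : ContinuousOn W (Set.uIcc z.re w.re ×ℂ Set.uIcc z.im w.im) :=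
    fun x hx => (hWx x hx).continuousAt.continuousWithinAt
  have hc : ContinuousOn (fun x : ℂ => ψ' x.re * W x) (Set.uIcc z.re w.re ×ℂ Set.uIcc z.im w.im) :=
    (hψ'.comp Complex.continuous_re).continuousOn.mul hcW
  have hcomp : IsCompact (Set.uIcc z.re w.re ×ℂ Set.uIcc z.im w.im) :=
    isCompact_uIcc.reProdIm isCompact_uIcc
  have key := Complex.integral_boundary_rect_of_differentiableOn_real f z w
    (fun x hx => (hder x hx).differentiableAt.differentiableWithinAt)
    (by
      refine IntegrableOn.congr_fun ((hc.integrableOn_compact hcomp).const_mul Complex.I)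
        (fun x hx => (hlin x hx).symm) hcomp.measurableSet)
  have e1 : ∀ c : ℝ, (∫ t in z.re..w.re, f (t + c * Complex.I)) =
      ∫ t in a..b, ψ t * W (t + c * Complex.I) := by
    intro c; simp [hf, hz, hw]
  have e2 : (∫ y in z.im..w.im, f (w.re + y * Complex.I)) = 0 := by
    simp [hf, hz, hw, hb]
  have e3 : (∫ y in z.im..w.im, f (z.re + y * Complex.I)) = 0 := by
    simp [hf, hz, hw, ha]
  rw [e1, e1, e2, e3] at key
  simp only [smul_zero, add_zero, sub_zero] at key
  rw [key]
  have e4 : (∫ x in z.re..w.re, ∫ y in z.im..w.im,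
      (Complex.I • fderiv ℝ f (x + y * Complex.I) 1 - fderiv ℝ f (x + y * Complex.I) Complex.I)) =
      ∫ x in a..b, ∫ y in s..s₀, Complex.I * (ψ' x * W (x + y * Complex.I)) := by
    refine intervalIntegral.integral_congr fun x hx => intervalIntegral.integral_congr fun y hy => ?_
    have := hlin (x + y * Complex.I) (by
      rw [Complex.mem_reProdIm]; simpa using And.intro hx hy)
    simpa using this
  rw [e4]
  simp_rw [intervalIntegral.integral_const_mul Complex.I]
  congr 1
  rw [intervalIntegral.integral_of_le hab, intervalIntegral.integral_of_le hs]
  simp_rw [intervalIntegral.integral_of_le hab, intervalIntegral.integral_of_le hs]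
  refine integral_integral_swap ?_
  rw [Measure.prod_restrict]
  refine IntegrableOn.mono_set (t := Set.Icc a b ×ˢ Set.Icc s s₀) ?_
    (Set.prod_mono Set.Ioc_subset_Icc_self Set.Ioc_subset_Icc_self)
  refine ContinuousOn.integrableOn_compact (isCompact_Icc.prod isCompact_Icc) ?_
  refine hc.comp (f := fun q : ℝ × ℝ => (q.1 + q.2 * Complex.I : ℂ)) (by fun_prop) ?_ |>.congr ?_
  · intro q hq
    rw [Complex.mem_reProdIm]
    simp only [hz, hw, Set.uIcc_of_le hab, Set.uIcc_of_le hs]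
    exact ⟨⟨by simpa using hq.1.1, by simpa using hq.1.2⟩, by simpa using hq.2.1, by simpa using hq.2.2⟩
  · intro q _
    simp [Function.uncurry]

theorem integral_exp_neg_mul_le {N s s₀ : ℝ} (hN : 0 < N) :
    (∫ σ in s..s₀, rexp (-(N * σ))) ≤ rexp (-(N * s)) / N := by
  have h : ∀ σ ∈ Set.uIcc s s₀, HasDerivAt (fun σ => -rexp (-(N * σ)) / N) (rexp (-(N * σ))) σ := by
    intro σ _
    have := (((hasDerivAt_id σ).const_mul N).neg.exp.neg).div_const N
    refine this.congr_deriv ?_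
    simp only [id, Pi.neg_apply]
    field_simp
  rw [intervalIntegral.integral_eq_sub_of_hasDerivAt h
    (Continuous.intervalIntegrable (by fun_prop) _ _)]
  have : 0 ≤ rexp (-(N * s₀)) / N := by positivity
  rw [neg_div, neg_div]; linarith

theorem norm_integral_mul_le_of_decay_one {a b s N K M : ℝ} (hab : a ≤ b)
    {ψ : ℝ → ℂ} {W : ℂ → ℂ} (hM : ∀ t, ‖ψ t‖ ≤ M)
    (hW : ∀ t ∈ Set.Icc a b, DifferentiableAt ℂ W (t + s * Complex.I))
    (hK : (∫ t in a..b, ‖W (t + s * Complex.I)‖) ≤ K * rexp (-(N * s))) :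
    ‖∫ t in a..b, ψ t * W (t + s * Complex.I)‖ ≤ M * K * rexp (-(N * s)) := by
  have hM0 : 0 ≤ M := (norm_nonneg _).trans (hM 0)
  have hc : ContinuousOn (fun t : ℝ => W (t + s * Complex.I)) (Set.uIcc a b) := by
    intro t ht
    rw [Set.uIcc_of_le hab] at ht
    have h1 : ContinuousAt (fun t : ℝ => (t + s * Complex.I : ℂ)) t := by fun_prop
    exact (ContinuousAt.comp (f := fun t : ℝ => (t + s * Complex.I : ℂ))
      (hW t ht).continuousAt h1).continuousWithinAt
  calc _ ≤ ∫ t in a..b, M * ‖W (t + s * Complex.I)‖ := by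
        refine intervalIntegral.norm_integral_le_of_norm_le hab (Eventually.of_forall fun t _ => ?_)
          (hc.norm.const_smul M).intervalIntegrable
        rw [norm_mul]
        exact mul_le_mul_of_nonneg_right (hM t) (norm_nonneg _)
    _ = M * ∫ t in a..b, ‖W (t + s * Complex.I)‖ := intervalIntegral.integral_const_mul _ _
    _ ≤ M * (K * rexp (-(N * s))) := mul_le_mul_of_nonneg_left hK hM0
    _ = _ := by ring

/-- Each use of Green's formula differentiates ψ once and gains 1/N by integrating e^{-Nσ}. A single
gain is not summable in N, hence two. The bound does not depend on s, so s can tend to 0 without any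
regularity of W on the real line. -/
theorem norm_integral_mul_le_of_decay {a b s s₀ N K M : ℝ} (hab : a ≤ b) (hs0 : 0 < s)
    (hs : s ≤ s₀) (hN : 0 < N) {ψ ψ' ψ'' : ℝ → ℂ} {W : ℂ → ℂ}
    (hψ : ∀ t, HasDerivAt ψ (ψ' t) t) (hψ' : ∀ t, HasDerivAt ψ' (ψ'' t) t)
    (hψ'' : Continuous ψ'') (ha : ψ a = 0) (hb : ψ b = 0) (ha' : ψ' a = 0) (hb' : ψ' b = 0)
    (hM : ∀ t, ‖ψ t‖ ≤ M) (hM' : ∀ t, ‖ψ' t‖ ≤ M) (hM'' : ∀ t, ‖ψ'' t‖ ≤ M) (hK0 : 0 ≤ K)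
    (hW : ∀ t ∈ Set.Icc a b, ∀ σ ∈ Set.Ioc 0 s₀, DifferentiableAt ℂ W (t + σ * Complex.I))
    (hK : ∀ σ ∈ Set.Ioc 0 s₀,
      (∫ t in a..b, ‖W (t + σ * Complex.I)‖) ≤ K * rexp (-(N * σ))) :
    ‖∫ t in a..b, ψ t * W (t + s * Complex.I)‖ ≤
      M * K * (rexp (-(N * s₀)) * (1 + s₀) + 1 / N ^ 2) := by
  have hM0 : 0 ≤ M := (norm_nonneg _).trans (hM 0)
  have hψc : Continuous ψ := continuous_iff_continuousAt.2 fun t => (hψ t).continuousAt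
  have hψc' : Continuous ψ' := continuous_iff_continuousAt.2 fun t => (hψ' t).continuousAt
  have hexp : ∀ u v : ℝ, IntervalIntegrable (fun σ => rexp (-(N * σ))) volume u v :=
    fun u v => Continuous.intervalIntegrable (by fun_prop) _ _
  have step : ∀ σ ∈ Set.Ioc 0 s₀, ‖∫ t in a..b, ψ' t * W (t + σ * Complex.I)‖ ≤
      M * K * (rexp (-(N * s₀)) + rexp (-(N * σ)) / N) := by
    intro σ hσ
    have e := integral_sub_integral_eq_of_differentiableAt hab hσ.2 hψ' hψ'' ha' hb'
      (W := W) (fun t ht τ hτ => hW t ht τ ⟨hσ.1.trans_le hτ.1, hτ.2⟩)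
    rw [sub_eq_iff_eq_add] at e
    rw [e]
    refine (norm_add_le _ _).trans ?_
    rw [norm_mul, Complex.norm_I, one_mul, add_comm, mul_add]
    refine add_le_add ?_ ?_
    · exact norm_integral_mul_le_of_decay_one hab hM'
        (fun t ht => hW t ht s₀ ⟨hs0.trans_le hs, le_rfl⟩) (hK s₀ ⟨hs0.trans_le hs, le_rfl⟩)
    · refine (intervalIntegral.norm_integral_le_of_norm_le hσ.2
        (g := fun τ => M * K * rexp (-(N * τ))) (Eventually.of_forall fun τ hτ => ?_)
        ((hexp _ _).const_mul _)).trans ?_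
      · have hτ' : τ ∈ Set.Ioc 0 s₀ := ⟨hσ.1.trans hτ.1, hτ.2⟩
        exact norm_integral_mul_le_of_decay_one hab hM''
          (fun t ht => hW t ht τ hτ') (hK τ hτ')
      · rw [intervalIntegral.integral_const_mul]
        exact mul_le_mul_of_nonneg_left (integral_exp_neg_mul_le hN) (by positivity)
  have e := integral_sub_integral_eq_of_differentiableAt hab hs hψ hψc' ha hb
      (W := W) (fun t ht τ hτ => hW t ht τ ⟨hs0.trans_le hτ.1, hτ.2⟩)
  rw [sub_eq_iff_eq_add] at e
  rw [e]
  refine (norm_add_le _ _).trans ?_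
  rw [norm_mul, Complex.norm_I, one_mul]
  have h1 : ‖∫ t in a..b, ψ t * W (t + s₀ * Complex.I)‖ ≤ M * K * rexp (-(N * s₀)) :=
    norm_integral_mul_le_of_decay_one hab hM
        (fun t ht => hW t ht s₀ ⟨hs0.trans_le hs, le_rfl⟩) (hK s₀ ⟨hs0.trans_le hs, le_rfl⟩)
  have h2 : ‖∫ σ in s..s₀, ∫ t in a..b, ψ' t * W (t + σ * Complex.I)‖ ≤
      M * K * (rexp (-(N * s₀)) * s₀ + 1 / N ^ 2) := by
    refine (intervalIntegral.norm_integral_le_of_norm_le hs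
        (g := fun τ => M * K * (rexp (-(N * s₀)) + rexp (-(N * τ)) / N))
        (Eventually.of_forall fun τ hτ => step τ ⟨hs0.trans hτ.1, hτ.2⟩)
        ((intervalIntegrable_const.add ((hexp _ _).div_const _)).const_mul _)).trans ?_
    rw [intervalIntegral.integral_const_mul]
    refine mul_le_mul_of_nonneg_left ?_ (by positivity)
    rw [intervalIntegral.integral_add intervalIntegrable_const ((hexp _ _).div_const _),
      intervalIntegral.integral_const, intervalIntegral.integral_div, smul_eq_mul]
    refine add_le_add ?_ ?_
    · rw [mul_comm]
      exact mul_le_mul_of_nonneg_left (by linarith) (exp_pos _).le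
    · rw [pow_two, ← div_div]
      refine div_le_div_of_nonneg_right ?_ hN.le
      refine (integral_exp_neg_mul_le hN).trans (div_le_div_of_nonneg_right ?_ hN.le)
      rw [exp_le_one_iff]
      have := mul_pos hN hs0
      linarith
  calc _ ≤ M * K * (rexp (-(N * s₀)) * s₀ + 1 / N ^ 2) + M * K * rexp (-(N * s₀)) :=
        add_le_add h2 h1
    _ = _ := by ring

/-! ### Poisson integrals and uniqueness of Fourier coefficients in L¹. -/

/-- The Poisson kernel of the unit disc at radius `r`. -/
def poisson (r : ℝ) (u : Torus) : ℝ := (1 - r ^ 2) / ‖1 - (r : ℂ) * pt u‖ ^ 2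

/-- The Poisson integral at radius `r` of a function on the circle. -/
def poissonInt (r : ℝ) (f : Torus → ℂ) (t : Torus) : ℂ := ∫ s, (poisson r (t - s) : ℂ) * f s ∂m

/-- The power series whose coefficients are the Fourier coefficients of nonnegative index. -/
def hardyExt (f : Torus → ℂ) (z : ℂ) : ℂ := ∑' n : ℕ, fourierCoeff f n * z ^ n


theorem pt_coe (t : ℝ) : pt (t : Torus) = Complex.exp (t * Complex.I) := by
  rw [pt, AddCircle.toCircle_apply_mk, Circle.coe_exp]
  congr 2
  have : (π : ℂ) ≠ 0 := by exact_mod_cast pi_ne_zero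
  push_cast
  field_simp

theorem fourier_natCast (n : ℕ) (t : Torus) : fourier (n : ℤ) t = pt t ^ n := by
  rw [fourier_apply, natCast_zsmul, AddCircle.toCircle_nsmul, Circle.coe_pow]; rfl

theorem norm_fourier_apply (n : ℤ) (t : Torus) : ‖(fourier n t : ℂ)‖ = 1 := Circle.norm_coe _

theorem fourier_sub_right (n : ℤ) (t s : Torus) :
    (fourier n (t - s) : ℂ) = fourier n t * fourier (-n) s := by
  simp [fourier_apply, sub_eq_add_neg, smul_add, AddCircle.toCircle_add]

theorem norm_fourierCoeff_le (f : Torus → ℂ) (n : ℤ) : ‖fourierCoeff f n‖ ≤ ∫ t, ‖f t‖ ∂m := by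
  refine (norm_integral_le_integral_norm _).trans (le_of_eq ?_)
  simp only [norm_smul, norm_fourier_apply, one_mul]

theorem norm_mul_pt_lt {r : ℝ} (hr0 : 0 ≤ r) (hr : r < 1) (t : Torus) : ‖(r : ℂ) * pt t‖ < 1 := by
  rw [norm_mul, norm_pt, mul_one, Complex.norm_real, norm_eq_abs, abs_of_nonneg hr0]; exact hr

theorem one_sub_mul_pt_ne_zero {r : ℝ} (hr0 : 0 ≤ r) (hr : r < 1) (t : Torus) :
    1 - (r : ℂ) * pt t ≠ 0 := by
  intro h
  have := norm_mul_pt_lt hr0 hr t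
  rw [← sub_eq_zero.1 h] at this
  simp at this

theorem poisson_nonneg {r : ℝ} (hr0 : 0 ≤ r) (hr : r < 1) (u : Torus) : 0 ≤ poisson r u := by
  refine div_nonneg ?_ (by positivity)
  nlinarith

theorem continuous_poisson {r : ℝ} (hr0 : 0 ≤ r) (hr : r < 1) : Continuous (poisson r) := by
  refine continuous_const.div (by have := continuous_pt; fun_prop) fun u => ?_
  have := one_sub_mul_pt_ne_zero hr0 hr u
  positivity

theorem poisson_neg (r : ℝ) (u : Torus) : poisson r (-u) = poisson r u := by
  have h : pt (-u) = conj (pt u) := by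
    rw [pt, AddCircle.toCircle_neg, Circle.coe_inv_eq_conj, pt]
  rw [poisson, poisson, h]
  congr 2
  rw [← Complex.norm_conj (1 - (r : ℂ) * pt u)]
  simp

/-- Sum of the geometric series in z and in conj z, with z = r e^{iu}. The index 0 occurs in both,
which accounts for the extra 1. -/
theorem hasSum_poisson {r : ℝ} (hr0 : 0 ≤ r) (hr : r < 1) (u : Torus) :
    HasSum (fun n : ℕ => (r : ℂ) ^ n * (fourier (n : ℤ) u + fourier (-n : ℤ) u))
      (poisson r u + 1) := by
  set z : ℂ := (r : ℂ) * pt u with hz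
  have hz1 := norm_mul_pt_lt hr0 hr u
  have hne : 1 - z ≠ 0 := one_sub_mul_pt_ne_zero hr0 hr u
  have h1 : HasSum (fun n : ℕ => z ^ n) (1 - z)⁻¹ := hasSum_geometric_of_norm_lt_one hz1
  have h2 : HasSum (fun n : ℕ => (conj z) ^ n) (1 - conj z)⁻¹ :=
    hasSum_geometric_of_norm_lt_one (by rwa [Complex.norm_conj])
  convert h1.add h2 using 1
  · funext n
    rw [fourier_neg, fourier_natCast, hz]
    simp only [map_mul, mul_pow, Complex.conj_ofReal, map_pow]
    ring
  · have hne' : 1 - conj z ≠ 0 := by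
      have := (map_ne_zero (starRingEnd ℂ)).2 hne
      rwa [map_sub, map_one] at this
    have hzz : z * conj z = (r : ℂ) ^ 2 := by
      rw [Complex.mul_conj, Complex.normSq_eq_norm_sq, hz, norm_mul, norm_pt]
      simp
    have hn : ((‖1 - z‖ ^ 2 : ℝ) : ℂ) = (1 - z) * (1 - conj z) := by
      rw [← Complex.normSq_eq_norm_sq, ← Complex.mul_conj]; simp
    rw [poisson, Complex.ofReal_div, hn]
    push_cast
    rw [← hzz]
    field_simp
    ring

theorem hasSum_poissonInt {r : ℝ} (hr0 : 0 ≤ r) (hr : r < 1) {f : Torus → ℂ}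
    (hf : Integrable f m) (t : Torus) :
    HasSum (fun n : ℕ => (r : ℂ) ^ n *
      (fourierCoeff f n * fourier (n : ℤ) t + fourierCoeff f (-n) * fourier (-n : ℤ) t))
      (poissonInt r f t + fourierCoeff f 0) := by
  have hcont : Continuous fun s : Torus => (poisson r (t - s) : ℂ) :=
    Complex.continuous_ofReal.comp
      ((continuous_poisson hr0 hr).comp (continuous_const.sub continuous_id))
  have hi : ∀ n : ℤ, Integrable (fun s => fourier n (t - s) * f s) m := fun n =>
    hf.bdd_mul (c := 1) (((map_continuous (fourier n)).comp
      (continuous_const.sub continuous_id)).aestronglyMeasurable)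
      (Eventually.of_forall fun s => (norm_fourier_apply _ _).le)
  have hv : ∀ n : ℤ, ∫ s, fourier n (t - s) * f s ∂m = fourierCoeff f n * fourier n t := by
    intro n
    rw [fourierCoeff, mul_comm (integral _ _) _, ← integral_const_mul]
    refine integral_congr_ae (Eventually.of_forall fun s => ?_)
    simp only [fourier_sub_right, smul_eq_mul]; ring
  have key := hasSum_integral_of_summable_integral_norm (μ := m)
    (F := fun (n : ℕ) s => (r : ℂ) ^ n * (fourier (n : ℤ) (t - s) * f s +
      fourier (-n : ℤ) (t - s) * f s))
    (fun n => ((hi n).add (hi (-n))).const_mul _) (by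
      refine Summable.of_nonneg_of_le (fun n => integral_nonneg fun s => norm_nonneg _)
        (fun n => ?_) ((summable_geometric_of_lt_one hr0 hr).mul_right (2 * ∫ s, ‖f s‖ ∂m))
      rw [← integral_const_mul, ← integral_const_mul]
      refine integral_mono_of_nonneg (Eventually.of_forall fun s => norm_nonneg _)
        ((hf.norm.const_mul _).const_mul _) (Eventually.of_forall fun s => ?_)
      simp only
      rw [norm_mul, norm_pow, Complex.norm_real, norm_eq_abs, abs_of_nonneg hr0]
      refine mul_le_mul_of_nonneg_left ((norm_add_le _ _).trans (le_of_eq ?_)) (by positivity)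
      rw [norm_mul, norm_mul, norm_fourier_apply, norm_fourier_apply]
      ring)
  have e1 : ∀ n : ℕ, ∫ s, (r : ℂ) ^ n * (fourier (n : ℤ) (t - s) * f s +
      fourier (-n : ℤ) (t - s) * f s) ∂m = (r : ℂ) ^ n *
      (fourierCoeff f n * fourier (n : ℤ) t + fourierCoeff f (-n) * fourier (-n : ℤ) t) := by
    intro n
    rw [integral_const_mul, integral_add (hi n) (hi (-n)), hv, hv]
  simp only [e1] at key
  have e2 : (∫ s, ∑' n : ℕ, (r : ℂ) ^ n * (fourier (n : ℤ) (t - s) * f s +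
      fourier (-n : ℤ) (t - s) * f s) ∂m) = poissonInt r f t + fourierCoeff f 0 := by
    have h1 : fourierCoeff f 0 = ∫ s, f s ∂m := by simp [fourierCoeff]
    unfold poissonInt
    rw [h1, ← integral_add _ hf]
    · refine integral_congr_ae (Eventually.of_forall fun s => ?_)
      have := ((hasSum_poisson hr0 hr (t - s)).mul_right (f s)).tsum_eq
      rw [add_mul, one_mul] at this
      simp only
      rw [← this]
      refine tsum_congr fun n => ?_
      ring
    · obtain ⟨C, hC⟩ := (isCompact_range hcont).isBounded.exists_norm_le
      exact hf.bdd_mul (c := C) hcont.aestronglyMeasurable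
        (Eventually.of_forall fun s => hC _ ⟨s, rfl⟩)
  rwa [e2] at key

/-- Links the two descriptions of f inside the disc: the power series supplies analyticity, the
Poisson integral supplies L¹ bounds and boundary convergence. -/
theorem poissonInt_eq_hardyExt {r : ℝ} (hr0 : 0 ≤ r) (hr : r < 1) {f : Torus → ℂ}
    (hf : Integrable f m) (h : ∀ n : ℤ, n < 0 → fourierCoeff f n = 0) (t : Torus) :
    poissonInt r f t = hardyExt f (r * pt t) := by
  have h1 := hasSum_poissonInt hr0 hr hf t
  have h2 := h1.sub (hasSum_ite_eq 0 (fourierCoeff f 0))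
  rw [add_sub_cancel_right] at h2
  rw [hardyExt, ← h2.tsum_eq]
  refine tsum_congr fun n => ?_
  rcases Nat.eq_zero_or_pos n with rfl | hn
  · simp only [pow_zero, Nat.cast_zero, neg_zero, fourier_zero, if_true]
    ring
  · rw [h (-n) (by omega), fourier_natCast, mul_pow, if_neg hn.ne']
    ring

theorem poissonInt_fourier {r : ℝ} (hr0 : 0 ≤ r) (hr : r < 1) (k : ℤ) (t : Torus) :
    poissonInt r (fourier k) t = (r : ℂ) ^ k.natAbs * fourier k t := by
  have h1 := hasSum_poissonInt hr0 hr
    (((map_continuous (fourier k : C(Torus, ℂ))).integrable_of_hasCompactSupport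
      (HasCompactSupport.of_compactSpace _)) : Integrable (fourier k : C(Torus, ℂ)) m) t
  have h2 := h1.sub (hasSum_ite_eq 0 (fourierCoeff (fourier k : C(Torus, ℂ)) 0))
  rw [add_sub_cancel_right] at h2
  rw [fourierCoeff_fourier] at h2
  refine h2.unique ?_
  refine (hasSum_ite_eq k.natAbs ((r : ℂ) ^ k.natAbs * fourier k t)).congr_fun fun n => ?_
  rcases Nat.eq_zero_or_pos n with rfl | hn
  · rcases eq_or_ne k 0 with rfl | hk
    · simp
    · have : 0 ≠ k.natAbs := by omega
      simp [hk.symm, this]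
  · rw [if_neg hn.ne', sub_zero]
    by_cases h3 : n = k.natAbs
    · rw [if_pos h3, ← h3]
      rcases Int.natAbs_eq k with h4 | h4
      · rw [← h3] at h4
        have h5 : -(n : ℤ) ≠ (n : ℤ) := by omega
        simp [-fourier_apply, h4, h5]
      · rw [← h3] at h4
        have h5 : (n : ℤ) ≠ k := by omega
        simp [-fourier_apply, ← h4, h5]
    · have h5 : (n : ℤ) ≠ k := by omega
      have h6 : -(n : ℤ) ≠ k := by omega
      simp [h3, h5, h6]

theorem integral_poisson {r : ℝ} (hr0 : 0 ≤ r) (hr : r < 1) (t : Torus) :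
    ∫ s, poisson r (s - t) ∂m = 1 := by
  have := poissonInt_fourier hr0 hr 0 t
  have h2 : ∫ s, (poisson r (s - t) : ℂ) ∂m = 1 := by
    rw [poissonInt] at this
    simp only [Int.natAbs_zero, pow_zero, fourier_zero, mul_one] at this
    rw [← this]
    refine integral_congr_ae (Eventually.of_forall fun s => ?_)
    simp only
    rw [← poisson_neg, neg_sub]
  rw [integral_complex_ofReal] at h2
  exact_mod_cast h2

theorem integrable_prod_poisson {r : ℝ} (hr0 : 0 ≤ r) (hr : r < 1) {f : Torus → ℂ}
    (hf : Integrable f m) :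
    Integrable (fun q : Torus × Torus => (poisson r (q.1 - q.2) : ℂ) * f q.2) (m.prod m) := by
  have hcont : Continuous fun q : Torus × Torus => (poisson r (q.1 - q.2) : ℂ) :=
    Complex.continuous_ofReal.comp ((continuous_poisson hr0 hr).comp (by fun_prop))
  obtain ⟨C, hC⟩ := (isCompact_range hcont).isBounded.exists_norm_le
  exact (hf.comp_snd m).bdd_mul (c := C) hcont.aestronglyMeasurable
        (Eventually.of_forall fun s => hC _ ⟨s, rfl⟩)

theorem integrable_poissonInt {r : ℝ} (hr0 : 0 ≤ r) (hr : r < 1) {f : Torus → ℂ}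
    (hf : Integrable f m) : Integrable (poissonInt r f) m :=
  (integrable_prod_poisson hr0 hr hf).integral_prod_left

/-- Fubini, and the fact that the kernel is nonnegative with mean one. -/
theorem integral_norm_poissonInt_le {r : ℝ} (hr0 : 0 ≤ r) (hr : r < 1) {f : Torus → ℂ}
    (hf : Integrable f m) : ∫ t, ‖poissonInt r f t‖ ∂m ≤ ∫ t, ‖f t‖ ∂m := by
  have hp := (integrable_prod_poisson hr0 hr hf).norm
  calc ∫ t, ‖poissonInt r f t‖ ∂m
      ≤ ∫ t, ∫ s, ‖(poisson r (t - s) : ℂ) * f s‖ ∂m ∂m :=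
        integral_mono (integrable_poissonInt hr0 hr hf).norm hp.integral_prod_left
          fun t => norm_integral_le_integral_norm _
    _ = ∫ s, ∫ t, ‖(poisson r (t - s) : ℂ) * f s‖ ∂m ∂m := integral_integral_swap hp
    _ = ∫ s, ‖f s‖ ∂m := by
        refine integral_congr_ae (Eventually.of_forall fun s => ?_)
        simp only [norm_mul, Complex.norm_real, norm_eq_abs, abs_of_nonneg (poisson_nonneg hr0 hr _)]
        rw [integral_mul_const, integral_poisson hr0 hr, one_mul]

theorem poissonInt_sub {r : ℝ} (hr0 : 0 ≤ r) (hr : r < 1) {f g : Torus → ℂ}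
    (hf : Integrable f m) (hg : Integrable g m) (t : Torus) :
    poissonInt r (fun s => f s - g s) t = poissonInt r f t - poissonInt r g t := by
  have hcont : Continuous fun s : Torus => (poisson r (t - s) : ℂ) :=
    Complex.continuous_ofReal.comp
      ((continuous_poisson hr0 hr).comp (continuous_const.sub continuous_id))
  obtain ⟨C, hC⟩ := (isCompact_range hcont).isBounded.exists_norm_le
  have hi : ∀ u : Torus → ℂ, Integrable u m → Integrable (fun s => (poisson r (t - s) : ℂ) * u s) m :=
    fun u hu => hu.bdd_mul (c := C) hcont.aestronglyMeasurable
        (Eventually.of_forall fun s => hC _ ⟨s, rfl⟩)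
  simp only [poissonInt, mul_sub]
  exact integral_sub (hi f hf) (hi g hg)

theorem integrable_continuousMap (g : C(Torus, ℂ)) : Integrable g m :=
  (map_continuous g).integrable_of_hasCompactSupport (HasCompactSupport.of_compactSpace _)

theorem poissonInt_const_mul (r : ℝ) (c : ℂ) (f : Torus → ℂ) (t : Torus) :
    poissonInt r (fun s => c * f s) t = c * poissonInt r f t := by
  unfold poissonInt
  rw [← integral_const_mul]
  refine integral_congr_ae (Eventually.of_forall fun s => ?_)
  simp only
  ring

theorem eventually_radius : ∀ᶠ r : ℝ in 𝓝[<] 1, 0 < r ∧ r < 1 :=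
  (Ioo_mem_nhdsLT (show (0 : ℝ) < 1 by norm_num))

theorem tendsto_poissonInt_of_mem_span {g : C(Torus, ℂ)}
    (hg : g ∈ Submodule.span ℂ (Set.range (fourier (T := 2 * π)))) :
    Tendsto (fun r => ∫ t, ‖poissonInt r g t - g t‖ ∂m) (𝓝[<] 1) (𝓝 0) := by
  induction hg using Submodule.span_induction with
  | mem g hg =>
    obtain ⟨k, rfl⟩ := hg
    have h1 : Tendsto (fun r : ℝ => |r ^ k.natAbs - 1|) (𝓝[<] 1) (𝓝 0) := by
      have : Tendsto (fun r : ℝ => |r ^ k.natAbs - 1|) (𝓝 1) (𝓝 |1 ^ k.natAbs - 1|) :=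
        Continuous.tendsto (by fun_prop) 1
      rw [one_pow, sub_self, abs_zero] at this
      exact this.mono_left nhdsWithin_le_nhds
    refine h1.congr' ?_
    filter_upwards [eventually_radius] with r hr
    have : ∀ t, ‖poissonInt r (fourier k) t - fourier k t‖ = |r ^ k.natAbs - 1| := by
      intro t
      rw [poissonInt_fourier hr.1.le hr.2, ← sub_one_mul, norm_mul, norm_fourier_apply, mul_one,
        ← norm_eq_abs, ← Complex.norm_real]
      simp
    simp only [this]
    simp
  | zero => simp [poissonInt]
  | add g h _ _ hg hh =>
    refine squeeze_zero' (Eventually.of_forall fun r => integral_nonneg fun t => norm_nonneg _) ?_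
      (by simpa using hg.add hh)
    filter_upwards [eventually_radius] with r hr
    have hi : ∀ u : C(Torus, ℂ), Integrable (fun t => poissonInt r u t - u t) m := fun u =>
      (integrable_poissonInt hr.1.le hr.2 (integrable_continuousMap u)).sub
        (integrable_continuousMap u)
    rw [← integral_add (hi g).norm (hi h).norm]
    refine integral_mono (hi (g + h)).norm ((hi g).norm.add (hi h).norm) fun t => ?_
    have h1 := poissonInt_sub hr.1.le hr.2 (integrable_continuousMap (g + h))
      (integrable_continuousMap h) t
    have h2 : (fun s => (g + h) s - h s) = g := by funext s; simp
    rw [h2] at h1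
    have h3 : poissonInt r (g + h : C(Torus, ℂ)) t - (g + h) t =
      (poissonInt r g t - g t) + (poissonInt r h t - h t) := by
      rw [h1]; simp; ring
    rw [h3]
    exact norm_add_le _ _
  | smul c g _ hg =>
    have h1 := hg.const_mul ‖c‖
    rw [mul_zero] at h1
    refine h1.congr fun r => ?_
    rw [← integral_const_mul]
    refine integral_congr_ae (Eventually.of_forall fun t => ?_)
    have h2 : poissonInt r (c • g : C(Torus, ℂ)) t = c * poissonInt r g t :=
      poissonInt_const_mul r c g t
    simp only [h2, ContinuousMap.smul_apply, smul_eq_mul, ← mul_sub, norm_mul]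

theorem exists_trigPoly_integral_norm_sub_lt {f : Torus → ℂ} (hf : Integrable f m) {ε : ℝ}
    (hε : 0 < ε) : ∃ g ∈ Submodule.span ℂ (Set.range (fourier (T := 2 * π))),
      ∫ t, ‖f t - g t‖ ∂m < ε := by
  have h1 : hf.toL1 ∈ (Submodule.span ℂ
      (Set.range (fourierLp (T := 2 * π) 1))).topologicalClosure := by
    rw [span_fourierLp_closure_eq_top ENNReal.one_ne_top]; trivial
  obtain ⟨q, hq, hd⟩ := Metric.mem_closure_iff.1 h1 ε hε
  have h2 : Submodule.span ℂ (Set.range (fourierLp (T := 2 * π) 1)) =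
      (Submodule.span ℂ (Set.range (fourier (T := 2 * π)))).map
        (ContinuousMap.toLp (E := ℂ) 1 m ℂ : C(Torus, ℂ) →ₗ[ℂ] Lp ℂ 1 m) := by
    rw [Submodule.map_span, ← Set.range_comp]; rfl
  rw [h2] at hq
  obtain ⟨g, hg, rfl⟩ := hq
  refine ⟨g, hg, ?_⟩
  rw [dist_eq_norm, L1.norm_eq_integral_norm] at hd
  refine lt_of_eq_of_lt (integral_congr_ae ?_) hd
  filter_upwards [Lp.coeFn_sub hf.toL1 (ContinuousMap.toLp (E := ℂ) 1 m ℂ g), hf.coeFn_toL1,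
    ContinuousMap.coeFn_toLp (p := 1) (𝕜 := ℂ) m g] with t h3 h4 h5
  simp only [ContinuousLinearMap.coe_coe]
  rw [h3, Pi.sub_apply, h4, h5]

/-- Poisson integration contracts L¹, so it suffices to check trigonometric polynomials, where it
multiplies the character of index k by r^|k|. -/
theorem tendsto_poissonInt {f : Torus → ℂ} (hf : Integrable f m) :
    Tendsto (fun r => ∫ t, ‖poissonInt r f t - f t‖ ∂m) (𝓝[<] 1) (𝓝 0) := by
  rw [Metric.tendsto_nhds]
  intro ε hε
  obtain ⟨g, hg, hfg⟩ := exists_trigPoly_integral_norm_sub_lt hf (show 0 < ε / 3 by positivity)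
  filter_upwards [eventually_radius, (tendsto_poissonInt_of_mem_span hg).eventually
    (gt_mem_nhds (show 0 < ε / 3 by positivity))] with r hr h
  have hgi := integrable_continuousMap g
  have hT : ∀ {u : Torus → ℂ}, Integrable u m → Integrable (poissonInt r u) m :=
    fun hu => integrable_poissonInt hr.1.le hr.2 hu
  rw [dist_zero_right, norm_of_nonneg (integral_nonneg fun t => norm_nonneg _)]
  have h1 := integral_norm_poissonInt_le hr.1.le hr.2 (hf.sub hgi)
  have h2 : ∫ t, ‖poissonInt r f t - f t‖ ∂m ≤ ∫ t, (‖poissonInt r (f - g) t‖ +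
      ‖poissonInt r g t - g t‖ + ‖f t - g t‖) ∂m := by
    refine integral_mono ((hT hf).sub hf).norm
      (((hT (hf.sub hgi)).norm.add ((hT hgi).sub hgi).norm).add (hf.sub hgi).norm) fun t => ?_
    have e : poissonInt r (f - g) t = poissonInt r f t - poissonInt r g t :=
      poissonInt_sub hr.1.le hr.2 hf hgi t
    simp only
    rw [e, norm_sub_rev (f t)]
    refine le_trans (le_of_eq ?_) (norm_add₃_le ..)
    congr 1; ring
  have i1 : Integrable (fun t => ‖poissonInt r (f - g) t‖) m := (hT (hf.sub hgi)).norm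
  have i2 : Integrable (fun t => ‖poissonInt r g t - g t‖) m := ((hT hgi).sub hgi).norm
  have i3 : Integrable (fun t => ‖f t - g t‖) m := (hf.sub hgi).norm
  have i4 : Integrable (fun t => ‖poissonInt r (f - g) t‖ + ‖poissonInt r g t - g t‖) m := i1.add i2
  rw [integral_add i4 i3, integral_add i1 i2] at h2
  simp only [Pi.sub_apply] at h1
  linarith

/-- The Poisson integrals of f vanish and converge to f in L¹. The L¹ form makes the case p = 1
available. -/
theorem ae_eq_zero_of_fourierCoeff_eq_zero {f : Torus → ℂ} (hf : Integrable f m)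
    (h : ∀ n, fourierCoeff f n = 0) : f =ᵐ[m] 0 := by
  have h1 := tendsto_poissonInt hf
  have h2 : Tendsto (fun r => ∫ t, ‖poissonInt r f t - f t‖ ∂m) (𝓝[<] 1) (𝓝 (∫ t, ‖f t‖ ∂m)) := by
    refine tendsto_const_nhds.congr' ?_
    filter_upwards [eventually_radius] with r hr
    refine integral_congr_ae (Eventually.of_forall fun t => ?_)
    have := hasSum_poissonInt hr.1.le hr.2 hf t
    simp only [h, zero_mul, add_zero, mul_zero] at this
    simp [this.unique hasSum_zero]
  have h3 := tendsto_nhds_unique h2 h1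
  rw [integral_eq_zero_iff_of_nonneg (fun t => norm_nonneg _) hf.norm] at h3
  filter_upwards [h3] with t ht
  simpa using ht

/-! ### Oscillatory integrals of boundary values of analytic functions. -/

theorem differentiableOn_hardyExt (f : Torus → ℂ) :
    DifferentiableOn ℂ (hardyExt f) (Metric.ball 0 1) := by
  intro z hz
  rw [mem_ball_zero_iff] at hz
  obtain ⟨ρ, hzρ, hρ⟩ := exists_between hz
  have h : DifferentiableOn ℂ (hardyExt f) (Metric.ball 0 ρ) := by
    refine Complex.differentiableOn_tsum_of_summable_norm
      (u := fun n : ℕ => (∫ t, ‖f t‖ ∂m) * ρ ^ n)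
      ((summable_geometric_of_lt_one ((norm_nonneg _).trans hzρ.le) hρ).mul_left _)
      (fun n => by fun_prop) Metric.isOpen_ball fun n w hw => ?_
    rw [mem_ball_zero_iff] at hw
    rw [norm_mul, norm_pow]
    exact mul_le_mul (norm_fourierCoeff_le f n) (pow_le_pow_left₀ (norm_nonneg _) hw.le _)
      (by positivity) (integral_nonneg fun t => norm_nonneg _)
  exact (h.differentiableAt (Metric.isOpen_ball.mem_nhds
    (by rwa [mem_ball_zero_iff]))).differentiableWithinAt

theorem integrable_volume_iff {f : Torus → ℂ} :
    Integrable f (volume : Measure Torus) ↔ Integrable f m := by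
  rw [← memLp_one_iff_integrable, ← memLp_one_iff_integrable, memLp_haarAddCircle_iff]

theorem intervalIntegrable_coe {f : Torus → ℂ} (hf : Integrable f m) {a b : ℝ}
    (hab : a ≤ b) (hlen : b ≤ a + 2 * π) :
    IntervalIntegrable (fun t : ℝ => f t) volume a b := by
  have h1 := (AddCircle.measurePreserving_mk (2 * π) a).integrable_comp_of_integrable
    (integrable_volume_iff.2 hf)
  rw [intervalIntegrable_iff_integrableOn_Ioc_of_le hab]
  exact IntegrableOn.mono_set h1 (Set.Ioc_subset_Ioc_right hlen)

theorem integral_norm_coe_le {f : Torus → ℂ} (hf : Integrable f m) {a b : ℝ}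
    (hab : a ≤ b) (hlen : b ≤ a + 2 * π) :
    (∫ t in a..b, ‖f t‖) ≤ 2 * π * ∫ t, ‖f t‖ ∂m := by
  have h1 : (∫ t in a..b, ‖f t‖) ≤ ∫ t in a..(a + 2 * π), ‖f t‖ :=
    intervalIntegral.integral_mono_interval le_rfl hab hlen
      (Eventually.of_forall fun t => norm_nonneg _)
      (intervalIntegrable_coe hf (hab.trans hlen) le_rfl).norm
  refine h1.trans (le_of_eq ?_)
  have h2 : (∫ t in a..(a + 2 * π), ‖f t‖) = ∫ t : Torus, ‖f t‖ :=
    AddCircle.intervalIntegral_preimage (2 * π) a fun t => ‖f t‖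
  rw [h2, AddCircle.integral_haarAddCircle, smul_eq_mul, mul_inv_cancel_left₀ (by positivity)]

theorem exp_add_mul_I (t s : ℝ) :
    Complex.exp ((t + s * Complex.I) * Complex.I) = (rexp (-s) : ℂ) * pt t := by
  rw [pt_coe, Complex.ofReal_exp, ← Complex.exp_add]
  congr 1
  push_cast
  linear_combination (s : ℂ) * Complex.I_sq

/-- The substitution z = e^{iw}, w = t + is, turns the sector into a rectangle. There z^N
contributes e^{-Ns}, h is bounded by B, and the L¹ norm of the extension of f over each circle is at
most that of f; the estimate is then carried to s = 0. -/
theorem norm_integral_bump_mul_le {a b s₀ B M : ℝ} (hab : a ≤ b) (hlen : b ≤ a + 2 * π)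
    (hs₀ : 0 < s₀) {ψ ψ' ψ'' : ℝ → ℂ}
    (hψ : ∀ t, HasDerivAt ψ (ψ' t) t) (hψ' : ∀ t, HasDerivAt ψ' (ψ'' t) t)
    (hψ'' : Continuous ψ'') (ha : ψ a = 0) (hb : ψ b = 0) (ha' : ψ' a = 0) (hb' : ψ' b = 0)
    (hM : ∀ t, ‖ψ t‖ ≤ M) (hM' : ∀ t, ‖ψ' t‖ ≤ M) (hM'' : ∀ t, ‖ψ'' t‖ ≤ M)
    {h : ℂ → ℂ} {k : Torus → ℂ} (hB0 : 0 ≤ B)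
    (hh : ∀ t ∈ Set.Icc a b, ∀ s ∈ Set.Ioc 0 s₀, DifferentiableAt ℂ h ((rexp (-s) : ℂ) * pt t))
    (hB : ∀ t ∈ Set.Icc a b, ∀ s ∈ Set.Ioc 0 s₀, ‖h ((rexp (-s) : ℂ) * pt t)‖ ≤ B)
    (hk : ∀ᵐ t : ℝ, t ∈ Set.Ioc a b →
      Tendsto (fun s : ℝ => h ((rexp (-s) : ℂ) * pt t)) (𝓝[>] 0) (𝓝 (k t)))
    {f : Torus → ℂ} (hf : Integrable f m) (hneg : ∀ n : ℤ, n < 0 → fourierCoeff f n = 0)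
    {N : ℕ} (hN : 0 < N) :
    ‖∫ t in a..b, ψ t * (pt t ^ N * f t * k t)‖ ≤
      M * (B * (2 * π * ∫ t, ‖f t‖ ∂m)) *
        (rexp (-(N * s₀)) * (1 + s₀) + 1 / (N : ℝ) ^ 2) := by
  have hM0 : 0 ≤ M := (norm_nonneg _).trans (hM 0)
  have hψc : Continuous ψ := continuous_iff_continuousAt.2 fun t => (hψ t).continuousAt
  have hptc : Continuous fun t : ℝ => pt t := continuous_pt.comp (AddCircle.continuous_mk' _)
  have hf0 : 0 ≤ ∫ t, ‖f t‖ ∂m := integral_nonneg fun t => norm_nonneg _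
  have hexp : ∀ {s : ℝ}, 0 < s → 0 < rexp (-s) ∧ rexp (-s) < 1 := fun hs =>
    ⟨exp_pos _, by rw [← exp_zero]; exact exp_lt_exp.2 (by linarith)⟩
  set W : ℂ → ℂ := fun w => Complex.exp (w * Complex.I) ^ N *
    hardyExt f (Complex.exp (w * Complex.I)) * h (Complex.exp (w * Complex.I)) with hW
  have hWeq : ∀ t s : ℝ, 0 < s → W (t + s * Complex.I) =
      ((rexp (-s) : ℂ) * pt t) ^ N * poissonInt (rexp (-s)) f t * h ((rexp (-s) : ℂ) * pt t) := by
    intro t s hs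
    simp only [hW]
    rw [exp_add_mul_I, poissonInt_eq_hardyExt (hexp hs).1.le (hexp hs).2 hf hneg]
  have hPi : ∀ s : ℝ, 0 < s → Integrable (poissonInt (rexp (-s)) f) m := fun s hs =>
    integrable_poissonInt (hexp hs).1.le (hexp hs).2 hf
  have hhc : ∀ s ∈ Set.Ioc 0 s₀, ContinuousOn (fun t : ℝ => h ((rexp (-s) : ℂ) * pt t))
      (Set.Icc a b) := by
    intro s hs t ht
    exact (ContinuousAt.comp (f := fun t : ℝ => (rexp (-s) : ℂ) * pt t) (hh t ht s hs).continuousAt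
      (continuous_const.mul hptc).continuousAt).continuousWithinAt
  have hwc : ∀ s ∈ Set.Ioc 0 s₀, ContinuousOn (fun t : ℝ => ψ t * (((rexp (-s) : ℂ) * pt t) ^ N *
      h ((rexp (-s) : ℂ) * pt t))) (Set.Icc a b) := fun s hs =>
    hψc.continuousOn.mul ((Continuous.continuousOn (by fun_prop)).mul (hhc s hs))
  have hwb : ∀ s ∈ Set.Ioc 0 s₀, ∀ t ∈ Set.Icc a b,
      ‖ψ t * (((rexp (-s) : ℂ) * pt t) ^ N * h ((rexp (-s) : ℂ) * pt t))‖ ≤ M * B := by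
    intro s hs t ht
    rw [norm_mul, norm_mul, norm_pow]
    have h1 : ‖(rexp (-s) : ℂ) * pt t‖ ≤ 1 :=
      (norm_mul_pt_lt (hexp hs.1).1.le (hexp hs.1).2 _).le
    refine mul_le_mul (hM t) ?_ (by positivity) hM0
    exact (mul_le_of_le_one_left (norm_nonneg _) (pow_le_one₀ (norm_nonneg _) h1)).trans
      (hB t ht s hs)
  have hmul : ∀ s ∈ Set.Ioc 0 s₀, ∀ u : Torus → ℂ, Integrable u m → IntervalIntegrable
      (fun t : ℝ => ψ t * (((rexp (-s) : ℂ) * pt t) ^ N * h ((rexp (-s) : ℂ) * pt t)) * u t)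
      volume a b := by
    intro s hs u hu
    refine IntervalIntegrable.continuousOn_mul (intervalIntegrable_coe hu hab hlen) ?_
    rw [Set.uIcc_of_le hab]
    exact hwc s hs
  have hbound : ∀ s ∈ Set.Ioc 0 s₀, ‖∫ t in a..b, ψ t * W (t + s * Complex.I)‖ ≤
      M * (B * (2 * π * ∫ t, ‖f t‖ ∂m)) *
        (rexp (-(N * s₀)) * (1 + s₀) + 1 / (N : ℝ) ^ 2) := by
    intro s hs
    refine norm_integral_mul_le_of_decay hab hs.1 hs.2 (by exact_mod_cast hN) hψ hψ' hψ'' ha hb ha'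
      hb' hM hM' hM'' (by positivity) ?_ ?_
    · intro t ht σ hσ
      have h1 : DifferentiableAt ℂ (hardyExt f)
          (Complex.exp ((t + σ * Complex.I) * Complex.I)) := by
        refine (differentiableOn_hardyExt f).differentiableAt (Metric.isOpen_ball.mem_nhds ?_)
        rw [mem_ball_zero_iff, exp_add_mul_I]
        exact norm_mul_pt_lt (hexp hσ.1).1.le (hexp hσ.1).2 _
      have h2 : DifferentiableAt ℂ h (Complex.exp ((t + σ * Complex.I) * Complex.I)) := by
        rw [exp_add_mul_I]; exact hh t ht σ hσ
      have h3 : DifferentiableAt ℂ (fun w : ℂ => Complex.exp (w * Complex.I))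
        (t + σ * Complex.I) := by fun_prop
      exact ((h3.pow N).mul (h1.comp (t + σ * Complex.I : ℂ) h3)).mul
        (h2.comp (t + σ * Complex.I : ℂ) h3)
    · intro σ hσ
      have h1 : (∫ t in a..b, ‖W (t + σ * Complex.I)‖) ≤
          ∫ t in a..b, rexp (-(N * σ)) * B * ‖poissonInt (rexp (-σ)) f t‖ := by
        refine intervalIntegral.integral_mono_on_of_le_Ioo hab ?_
          ((intervalIntegrable_coe (hPi σ hσ.1) hab hlen).norm.const_mul _) fun t ht => ?_
        · have h2 : IntervalIntegrable (fun t : ℝ => ((rexp (-σ) : ℂ) * pt t) ^ N *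
              h ((rexp (-σ) : ℂ) * pt t) * poissonInt (rexp (-σ)) f t) volume a b := by
            refine (intervalIntegrable_coe (hPi σ hσ.1) hab hlen).continuousOn_mul ?_
            rw [Set.uIcc_of_le hab]
            exact (Continuous.continuousOn (by fun_prop)).mul (hhc σ hσ)
          refine (h2.congr fun t _ => ?_).norm
          rw [hWeq _ _ hσ.1]; ring
        · rw [hWeq _ _ hσ.1, norm_mul, norm_mul, norm_pow, norm_mul, norm_pt, mul_one,
            Complex.norm_real, norm_of_nonneg (exp_pos _).le, ← exp_nat_mul, mul_neg,
            mul_right_comm]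
          exact mul_le_mul_of_nonneg_right (mul_le_mul_of_nonneg_left
            (hB t ⟨ht.1.le, ht.2.le⟩ σ hσ) (exp_pos _).le) (norm_nonneg _)
      refine h1.trans ?_
      rw [intervalIntegral.integral_const_mul, mul_assoc, mul_comm]
      refine mul_le_mul_of_nonneg_right (mul_le_mul_of_nonneg_left ?_ hB0) (exp_pos _).le
      refine (integral_norm_coe_le (hPi σ hσ.1) hab hlen).trans ?_
      exact mul_le_mul_of_nonneg_left
        (integral_norm_poissonInt_le (hexp hσ.1).1.le (hexp hσ.1).2 hf) (by positivity)
  have hev : ∀ᶠ s : ℝ in 𝓝[>] 0, s ∈ Set.Ioc 0 s₀ := Ioc_mem_nhdsGT hs₀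
  -- The boundary limit is split in two: the Poisson integral is replaced by f using L¹ convergence
  -- against bounded weights, then the weights converge by dominated convergence with f fixed
  -- (`hdom`).
  have hdiff : Tendsto (fun s : ℝ => ∫ t in a..b, ψ t * (((rexp (-s) : ℂ) * pt t) ^ N *
      h ((rexp (-s) : ℂ) * pt t)) * (poissonInt (rexp (-s)) f t - f t)) (𝓝[>] 0) (𝓝 0) := by
    have hr : Tendsto (fun s : ℝ => rexp (-s)) (𝓝[>] 0) (𝓝[<] 1) := by
      refine tendsto_nhdsWithin_iff.2 ⟨?_, ?_⟩
      · have : Tendsto (fun s : ℝ => rexp (-s)) (𝓝 0) (𝓝 (rexp (-0))) :=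
          Continuous.tendsto (by fun_prop) 0
        rw [neg_zero, exp_zero] at this
        exact this.mono_left nhdsWithin_le_nhds
      · filter_upwards [self_mem_nhdsWithin] with s hs
        exact (hexp hs).2
    have h1 := ((tendsto_poissonInt hf).comp hr).const_mul (M * B * (2 * π))
    rw [mul_zero] at h1
    refine squeeze_zero_norm' ?_ h1
    filter_upwards [hev] with s hs
    have h2 : Integrable (fun t => poissonInt (rexp (-s)) f t - f t) m := (hPi s hs.1).sub hf
    refine (intervalIntegral.norm_integral_le_of_norm_le hab
      (g := fun t : ℝ => M * B * ‖poissonInt (rexp (-s)) f t - f t‖)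
      (Eventually.of_forall fun t ht => ?_)
      ((intervalIntegrable_coe h2 hab hlen).norm.const_mul _)).trans ?_
    · rw [norm_mul]
      exact mul_le_mul_of_nonneg_right (hwb s hs t (Set.Ioc_subset_Icc_self ht)) (norm_nonneg _)
    · rw [intervalIntegral.integral_const_mul, mul_assoc (M * B)]
      exact mul_le_mul_of_nonneg_left (integral_norm_coe_le h2 hab hlen) (by positivity)
  have hdom : Tendsto (fun s : ℝ => ∫ t in a..b, ψ t * (((rexp (-s) : ℂ) * pt t) ^ N *
      h ((rexp (-s) : ℂ) * pt t)) * f t) (𝓝[>] 0)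
      (𝓝 (∫ t in a..b, ψ t * (pt t ^ N * f t * k t))) := by
    refine intervalIntegral.tendsto_integral_filter_of_dominated_convergence
      (fun t : ℝ => M * B * ‖f t‖) ?_ ?_ ((intervalIntegrable_coe hf hab hlen).norm.const_mul _) ?_
    · filter_upwards [hev] with s hs
      rw [Set.uIoc_of_le hab]
      exact (intervalIntegrable_iff_integrableOn_Ioc_of_le hab).1 (hmul s hs f hf) |>.1
    · filter_upwards [hev] with s hs
      refine Eventually.of_forall fun t ht => ?_
      rw [Set.uIoc_of_le hab] at ht
      rw [norm_mul]
      exact mul_le_mul_of_nonneg_right (hwb s hs t (Set.Ioc_subset_Icc_self ht)) (norm_nonneg _)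
    · filter_upwards [hk] with t ht ht'
      rw [Set.uIoc_of_le hab] at ht'
      have h1 : Tendsto (fun s : ℝ => ((rexp (-s) : ℂ) * pt t) ^ N) (𝓝[>] 0) (𝓝 (pt t ^ N)) := by
        have : Tendsto (fun s : ℝ => ((rexp (-s) : ℂ) * pt t) ^ N) (𝓝 0)
            (𝓝 ((((rexp (-0) : ℝ) : ℂ) * pt t) ^ N)) := Continuous.tendsto (by fun_prop) 0
        simp only [neg_zero, exp_zero, Complex.ofReal_one, one_mul] at this
        exact this.mono_left nhdsWithin_le_nhds
      have h2 := ((h1.mul (ht ht')).const_mul (ψ t)).mul_const (f t)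
      convert h2 using 2
      ring
  have hsum := hdiff.add hdom
  rw [zero_add] at hsum
  refine le_of_tendsto hsum.norm ?_
  filter_upwards [hev] with s hs
  rw [← intervalIntegral.integral_add (hmul s hs (fun t => poissonInt (rexp (-s)) f t - f t)
    ((hPi s hs.1).sub hf)) (hmul s hs f hf)]
  refine le_trans (le_of_eq ?_) (hbound s hs)
  congr 1
  refine intervalIntegral.integral_congr fun t _ => ?_
  rw [hWeq _ _ hs.1]
  ring

/-! ### Smooth bumps and quadratic decay. -/

/-- A smooth bump around the angle `x₀`, as a `2π`-periodic function on the line. -/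
def bumpLine (x₀ d x : ℝ) : ℝ := smoothTransition (cos (x - x₀) - cos d)

/-- A smooth bump around the angle `x₀`, as a function on the circle. -/
def bump (x₀ d : ℝ) : C(Torus, ℂ) where
  toFun t := (smoothTransition ((pt t * conj (pt (x₀ : Torus))).re - cos d) : ℂ)
  continuous_toFun := by
    have := continuous_pt
    exact Complex.continuous_ofReal.comp (smoothTransition.continuous.comp (by fun_prop))

theorem bump_coe (x₀ d x : ℝ) : bump x₀ d (x : Torus) = bumpLine x₀ d x := by
  have h : (pt (x : Torus) * conj (pt (x₀ : Torus))).re = cos (x - x₀) := by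
    rw [pt_coe, pt_coe, cos_sub]
    simp [Complex.exp_ofReal_mul_I_re, Complex.exp_ofReal_mul_I_im]
  simp only [bump, ContinuousMap.coe_mk, bumpLine, h]

theorem conj_bump (x₀ d : ℝ) (t : Torus) : conj (bump x₀ d t) = bump x₀ d t := by
  simp [bump]

theorem bumpLine_self_ne_zero {x₀ d : ℝ} (hd0 : 0 < d) (hd : d ≤ π) : bumpLine x₀ d x₀ ≠ 0 := by
  refine (smoothTransition.pos_of_pos ?_).ne'
  rw [sub_self, cos_zero, sub_pos, ← cos_zero]
  exact cos_lt_cos_of_nonneg_of_le_pi le_rfl hd hd0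

theorem bumpLine_eq_zero {x₀ d x : ℝ} (hd0 : 0 < d) (h1 : d ≤ |x - x₀|) (h2 : |x - x₀| ≤ π) :
    bumpLine x₀ d x = 0 := by
  refine smoothTransition.zero_of_nonpos ?_
  rw [sub_nonpos, ← cos_abs]
  exact cos_le_cos_of_nonneg_of_le_pi hd0.le h2 h1

theorem exists_deriv_bumpLine (x₀ d : ℝ) : ∃ (ψ' ψ'' : ℝ → ℂ) (M : ℝ),
    (∀ x, HasDerivAt (fun x => (bumpLine x₀ d x : ℂ)) (ψ' x) x) ∧
    (∀ x, HasDerivAt ψ' (ψ'' x) x) ∧ Continuous ψ'' ∧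
    (∀ x, ‖(bumpLine x₀ d x : ℂ)‖ ≤ M) ∧ (∀ x, ‖ψ' x‖ ≤ M) ∧ (∀ x, ‖ψ'' x‖ ≤ M) := by
  set ψ : ℝ → ℂ := fun x => (bumpLine x₀ d x : ℂ) with hψ
  have hper : Function.Periodic ψ (2 * π) := by
    intro x
    simp only [hψ, bumpLine]
    rw [add_sub_right_comm, cos_add_two_pi]
  have hc : ContDiff ℝ 2 ψ := by
    refine Complex.ofRealCLM.contDiff.comp (smoothTransition.contDiff.comp ?_)
    fun_prop
  have hdper : ∀ {u : ℝ → ℂ}, Function.Periodic u (2 * π) → Function.Periodic (deriv u) (2 * π) := by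
    intro u hu x
    rw [← deriv_comp_add_const]
    congr 1
    exact funext hu
  have hc' : ContDiff ℝ 1 (deriv ψ) := (contDiff_succ_iff_deriv.1 hc).2.2
  have hc'' : Continuous (deriv (deriv ψ)) := hc'.continuous_deriv le_rfl
  have hb : ∀ {u : ℝ → ℂ}, Function.Periodic u (2 * π) → Continuous u → ∃ M, ∀ x, ‖u x‖ ≤ M := by
    intro u hu huc
    obtain ⟨M, hM⟩ := (hu.isBounded_of_continuous (by positivity) huc).exists_norm_le
    exact ⟨M, fun x => hM _ ⟨x, rfl⟩⟩
  obtain ⟨M₀, h0⟩ := hb hper hc.continuous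
  obtain ⟨M₁, h1⟩ := hb (hdper hper) hc'.continuous
  obtain ⟨M₂, h2⟩ := hb (hdper (hdper hper)) hc''
  refine ⟨deriv ψ, deriv (deriv ψ), max M₀ (max M₁ M₂), fun x => ?_, fun x => ?_, hc'',
    fun x => (h0 x).trans (le_max_left _ _), fun x => (h1 x).trans ?_, fun x => (h2 x).trans ?_⟩
  · exact (hc.differentiable (by norm_num) x).hasDerivAt
  · exact (hc'.differentiable (by norm_num) x).hasDerivAt
  · exact (le_max_left _ _).trans (le_max_right _ _)
  · exact (le_max_right _ _).trans (le_max_right _ _)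

theorem integral_bump_mul {x₀ d : ℝ} (hd0 : 0 < d) (hd : 2 * d ≤ π) (u : Torus → ℂ) :
    ∫ t, bump x₀ d t * u t ∂m =
      (2 * π : ℂ)⁻¹ * ∫ x in (x₀ - 2 * d)..(x₀ + 2 * d), (bumpLine x₀ d x : ℂ) * u x := by
  rw [AddCircle.integral_haarAddCircle, ← AddCircle.intervalIntegral_preimage (2 * π) (x₀ - π)]
  rw [Complex.real_smul]
  push_cast
  congr 1
  simp only [bump_coe]
  rw [intervalIntegral.integral_of_le (by linarith [pi_pos]),
    intervalIntegral.integral_of_le (by linarith)]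
  refine setIntegral_eq_of_subset_of_forall_sdiff_eq_zero measurableSet_Ioc
    (Set.Ioc_subset_Ioc (by linarith) (by linarith)) fun x hx => ?_
  rw [bumpLine_eq_zero hd0, Complex.ofReal_zero, zero_mul]
  · by_contra hlt
    rw [not_le, abs_lt] at hlt
    exact hx.2 ⟨by linarith [hlt.1], by linarith [hlt.2]⟩
  · rw [abs_le]
    exact ⟨by linarith [hx.1.1], by linarith [hx.1.2]⟩

theorem exp_neg_le_two_div_sq {x : ℝ} (hx : 0 < x) : rexp (-x) ≤ 2 / x ^ 2 := by
  rw [exp_neg, inv_le_comm₀ (exp_pos _) (by positivity), inv_div]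
  have := quadratic_le_exp_of_nonneg hx.le
  linarith

/-- If `h` is bounded and analytic in the disc near an arc, with boundary values `k`, then the
products of functions in `H¹` with `k` and with a bump supported in the arc have Fourier
coefficients of negative index that decay quadratically. -/
theorem exists_norm_integral_bump_mul_le {x₀ d s₀ B : ℝ} (hd0 : 0 < d) (hd : 2 * d ≤ π)
    (hs₀ : 0 < s₀) (hB0 : 0 ≤ B) {h : ℂ → ℂ} {k : Torus → ℂ}
    (hh : ∀ t ∈ Set.Icc (x₀ - 2 * d) (x₀ + 2 * d), ∀ s ∈ Set.Ioc 0 s₀,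
      DifferentiableAt ℂ h ((rexp (-s) : ℂ) * pt t) ∧ ‖h ((rexp (-s) : ℂ) * pt t)‖ ≤ B)
    (hk : ∀ᵐ t : ℝ, t ∈ Set.Ioc (x₀ - 2 * d) (x₀ + 2 * d) →
      Tendsto (fun s : ℝ => h ((rexp (-s) : ℂ) * pt t)) (𝓝[>] 0) (𝓝 (k t))) :
    ∃ C, ∀ f : Torus → ℂ, Integrable f m → (∀ n : ℤ, n < 0 → fourierCoeff f n = 0) →
      ∀ N : ℕ, 0 < N →
        ‖∫ t, bump x₀ d t * (pt t ^ N * f t * k t) ∂m‖ ≤ C * (∫ t, ‖f t‖ ∂m) / (N : ℝ) ^ 2 := by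
  obtain ⟨ψ', ψ'', M, hψ, hψ', hψ'', hM, hM', hM''⟩ := exists_deriv_bumpLine x₀ d
  -- The interval is twice as long as the support of the bump, so the bump vanishes in a
  -- neighbourhood of each endpoint and its derivative vanishes there too.
  have hz : ∀ x : ℝ, |x - x₀| = 2 * d → bumpLine x₀ d x = 0 ∧ ψ' x = 0 := by
    intro x hx
    refine ⟨bumpLine_eq_zero hd0 (by linarith) (by linarith), ?_⟩
    have h1 : (fun x => (bumpLine x₀ d x : ℂ)) =ᶠ[𝓝 x] fun _ => 0 := by
      have h2 : ∀ᶠ y in 𝓝 x, cos (y - x₀) < cos d := by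
        refine ContinuousAt.eventually_lt (by fun_prop) continuousAt_const ?_
        rw [← cos_abs, hx]
        exact cos_lt_cos_of_nonneg_of_le_pi hd0.le hd (by linarith)
      filter_upwards [h2] with y hy
      rw [bumpLine, smoothTransition.zero_of_nonpos (by linarith), Complex.ofReal_zero]
    exact (hψ x).unique ((hasDerivAt_const x (0 : ℂ)).congr_of_eventuallyEq h1)
  have ha := hz (x₀ - 2 * d) (by rw [sub_sub_cancel_left, abs_neg, abs_of_pos (by linarith)])
  have hb := hz (x₀ + 2 * d) (by rw [add_sub_cancel_left, abs_of_pos (by linarith)])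
  have hM0 : 0 ≤ M := (norm_nonneg _).trans (hM 0)
  -- The term e^{-N s₀} is absorbed into N⁻² by e^{-x} ≤ 2/x² at x = N s₀; the factor 2π cancels
  -- against the normalization of `m`.
  refine ⟨M * B * ((2 / s₀ ^ 2) * (1 + s₀) + 1), fun f hf hneg N hN => ?_⟩
  have hN' : (0 : ℝ) < N := by exact_mod_cast hN
  have key := norm_integral_bump_mul_le (a := x₀ - 2 * d) (b := x₀ + 2 * d) (by linarith)
    (by linarith) hs₀ hψ hψ' hψ'' (by simp [ha.1]) (by simp [hb.1]) ha.2 hb.2 hM hM' hM'' hB0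
    (fun t ht s hs => (hh t ht s hs).1) (fun t ht s hs => (hh t ht s hs).2) hk hf hneg hN
  have hf0 : 0 ≤ ∫ t, ‖f t‖ ∂m := integral_nonneg fun t => norm_nonneg _
  have hπ : ‖(2 * π : ℂ)⁻¹‖ = (2 * π)⁻¹ := by
    rw [norm_inv, ← Complex.ofReal_ofNat, ← Complex.ofReal_mul, Complex.norm_real,
      norm_of_nonneg (by positivity)]
  rw [integral_bump_mul hd0 hd, norm_mul, hπ]
  have he := exp_neg_le_two_div_sq (mul_pos hN' hs₀)
  calc _ ≤ (2 * π)⁻¹ * (M * (B * (2 * π * ∫ t, ‖f t‖ ∂m)) *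
        (2 / (N * s₀) ^ 2 * (1 + s₀) + 1 / (N : ℝ) ^ 2)) := by
        refine mul_le_mul_of_nonneg_left (key.trans ?_) (by positivity)
        refine mul_le_mul_of_nonneg_left ?_ (by positivity)
        gcongr
    _ = _ := by field_simp

/-! ### Coefficient decay away from ρ(Θ). -/

namespace InnerFunction
variable (Θ : InnerFunction)

theorem exists_lt_norm_of_notMem_rho {t : Torus} (ht : t ∉ Θ.rho) :
    ∃ δ > 0, ∀ᶠ z in 𝓝[Metric.ball 0 1] (pt t), δ < ‖Θ.toFun z‖ := by
  have hmem : pt t ∈ Metric.closedBall (0 : ℂ) 1 := by simp [norm_pt]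
  have hne : (𝓝[Metric.ball (0 : ℂ) 1] (pt t)).NeBot := by
    rw [← mem_closure_iff_nhdsWithin_neBot, closure_ball _ one_ne_zero]; exact hmem
  have h1 : liminf (fun z : ℂ => ‖Θ.toFun z‖) (𝓝[Metric.ball 0 1] (pt t)) ≠ 0 :=
    fun h => ht ⟨hmem, h⟩
  obtain ⟨C, hC⟩ := Θ.bounded
  -- The `liminf` is taken in ℝ, so boundedness of Θ and nontriviality of the filter are needed to
  -- conclude that it is nonnegative; being nonzero, it is then positive.
  have hub : IsBoundedUnder (· ≤ ·) (𝓝[Metric.ball 0 1] (pt t)) fun z : ℂ => ‖Θ.toFun z‖ :=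
    ⟨C, by rw [eventually_map]; filter_upwards [self_mem_nhdsWithin] with z hz using hC z hz⟩
  have h2 : 0 ≤ liminf (fun z : ℂ => ‖Θ.toFun z‖) (𝓝[Metric.ball 0 1] (pt t)) :=
    le_liminf_of_le hub.isCoboundedUnder_ge (Eventually.of_forall fun z => norm_nonneg _)
  obtain ⟨δ, hδ, hδ'⟩ := exists_between (lt_of_le_of_ne h2 h1.symm)
  exact ⟨δ, hδ, eventually_lt_of_lt_liminf hδ'
    ⟨0, by rw [eventually_map]; exact Eventually.of_forall fun z => norm_nonneg _⟩⟩

theorem exists_sector_of_notMem_rho {x₀ : ℝ} (hx : (x₀ : Torus) ∉ Θ.rho) :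
    ∃ d s₀ δ : ℝ, 0 < d ∧ 2 * d ≤ π ∧ 0 < s₀ ∧ 0 < δ ∧
      ∀ t ∈ Set.Icc (x₀ - 2 * d) (x₀ + 2 * d), ∀ s ∈ Set.Ioc 0 s₀,
        δ < ‖Θ.toFun ((rexp (-s) : ℂ) * pt t)‖ := by
  obtain ⟨δ, hδ, h⟩ := Θ.exists_lt_norm_of_notMem_rho hx
  rw [eventually_nhdsWithin_iff] at h
  have hc : Tendsto (fun q : ℝ × ℝ => (rexp (-q.2) : ℂ) * pt q.1) (𝓝 (x₀, 0))
      (𝓝 (pt (x₀ : Torus))) := by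
    have hptc : Continuous fun t : ℝ => pt t := continuous_pt.comp (AddCircle.continuous_mk' _)
    have : Continuous fun q : ℝ × ℝ => (rexp (-q.2) : ℂ) * pt q.1 :=
      Continuous.mul (by fun_prop) (hptc.comp continuous_fst)
    simpa using this.tendsto (x₀, 0)
  obtain ⟨ε, hε, hb⟩ := Metric.eventually_nhds_iff_ball.1 (hc.eventually h)
  -- Half-width 2d ≤ ε/2 and depth ε/2 keep the rectangle in the sup-norm ball of radius ε; the π/2
  -- ensures 2d ≤ π.
  refine ⟨min (ε / 4) (π / 2), ε / 2, δ, by positivity, ?_, by positivity, hδ, ?_⟩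
  · linarith [min_le_right (ε / 4) (π / 2)]
  · intro t ht s hs
    have hd := min_le_left (ε / 4) (π / 2)
    refine hb (t, s) ?_ ?_
    · rw [Metric.mem_ball, Prod.dist_eq, max_lt_iff]
      simp only [Real.dist_eq, abs_lt]
      exact ⟨⟨by linarith [ht.1], by linarith [ht.2]⟩, by linarith [hs.1], by linarith [hs.2]⟩
    · rw [mem_ball_zero_iff]
      exact norm_mul_pt_lt (exp_pos _).le (by rw [← exp_zero]; exact exp_lt_exp.2 (by linarith [hs.1])) _

theorem tendsto_exp_bdry : ∀ᵐ t : Torus ∂m,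
    Tendsto (fun s : ℝ => Θ.toFun ((rexp (-s) : ℂ) * pt t)) (𝓝[>] 0) (𝓝 (Θ.bdry t)) := by
  have hr : Tendsto (fun s : ℝ => rexp (-s)) (𝓝[>] 0) (𝓝[<] 1) := by
    refine tendsto_nhdsWithin_iff.2 ⟨?_, ?_⟩
    · have : Tendsto (fun s : ℝ => rexp (-s)) (𝓝 0) (𝓝 (rexp (-0))) :=
        Continuous.tendsto (by fun_prop) 0
      rw [neg_zero, exp_zero] at this
      exact this.mono_left nhdsWithin_le_nhds
    · filter_upwards [self_mem_nhdsWithin] with s hs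
      rw [Set.mem_Iio, ← exp_zero]
      exact exp_lt_exp.2 (by linarith [Set.mem_Ioi.1 hs])
  filter_upwards [Θ.radial] with t ⟨c, _, h⟩
  rw [bdry, h.limUnder_eq]
  exact h.comp hr

theorem ae_coe {P : Torus → Prop} (h : ∀ᵐ t ∂m, P t) (a b : ℝ) (hlen : b ≤ a + 2 * π) :
    ∀ᵐ t : ℝ, t ∈ Set.Ioc a b → P t := by
  have h1 : ∀ᵐ t ∂(volume : Measure Torus), P t := by
    rw [AddCircle.volume_eq_smul_haarAddCircle]
    exact Measure.ae_smul_measure h _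
  have h2 := (AddCircle.measurePreserving_mk (2 * π) a).quasiMeasurePreserving.ae h1
  rw [ae_restrict_iff' measurableSet_Ioc] at h2
  filter_upwards [h2] with t ht ht'
  exact ht ⟨ht'.1, ht'.2.trans hlen⟩

theorem conj_bdry_mul_bdry : ∀ᵐ t ∂m, conj (Θ.bdry t) * Θ.bdry t = 1 := by
  filter_upwards [Θ.norm_bdry] with t ht
  rw [mul_comm, Complex.mul_conj, Complex.normSq_eq_norm_sq, ht]; simp

/-- The frequency weight governing the Fourier coefficients of index `n`. -/
def freq (n : ℤ) : ℕ := if n < 0 then n.natAbs else n.natAbs + 1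

theorem summable_inv_freq_sq : Summable fun n : ℤ => 1 / (freq n : ℝ) ^ 2 := by
  have h : Summable fun n : ℕ => 1 / ((n + 1 : ℕ) : ℝ) ^ 2 :=
    (summable_nat_add_iff 1).2 (Real.summable_one_div_nat_pow.2 one_lt_two)
  refine Summable.of_nat_of_neg_add_one ?_ ?_
  · refine h.congr fun n => ?_
    simp [freq]
  · refine h.congr fun n => ?_
    have h1 : -((n : ℤ) + 1) < 0 := by omega
    have h2 : (-((n : ℤ) + 1)).natAbs = n + 1 := by omega
    rw [freq, if_pos h1, h2]

/-- The factor conj(Θ) makes both halves of the spectrum accessible: it equals 1/Θ on the circle,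
and it turns f into conj(z g). -/
theorem exists_norm_fourierCoeff_bump_mul_le {x₀ : ℝ} (hx : (x₀ : Torus) ∉ Θ.rho) :
    ∃ d : ℝ, bump x₀ d x₀ ≠ 0 ∧ ∃ C, ∀ f g : Torus → ℂ, Integrable f m → Integrable g m →
      (∀ n : ℤ, n < 0 → fourierCoeff f n = 0) → (∀ n : ℤ, n < 0 → fourierCoeff g n = 0) →
      (f =ᵐ[m] fun t => Θ.bdry t * conj (pt t * g t)) → ∀ n : ℤ,
      ‖fourierCoeff (fun t => bump x₀ d t * (conj (Θ.bdry t) * f t)) n‖ ≤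
        C * (∫ t, ‖f t‖ ∂m) * (1 / (freq n : ℝ) ^ 2) := by
  obtain ⟨d, s₀, δ, hd0, hd, hs₀, hδ, hsec⟩ := Θ.exists_sector_of_notMem_rho hx
  refine ⟨d, ?_, ?_⟩
  · rw [bump_coe]
    exact_mod_cast bumpLine_self_ne_zero hd0 (by linarith)
  obtain ⟨C₁, h1⟩ := exists_norm_integral_bump_mul_le (B := δ⁻¹) hd0 hd hs₀ (by positivity)
    (h := fun z => (Θ.toFun z)⁻¹) (k := fun t => conj (Θ.bdry t)) (fun t ht s hs => by
      have h2 := hsec t ht s hs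
      have h3 : DifferentiableAt ℂ Θ.toFun ((rexp (-s) : ℂ) * pt t) := by
        refine Θ.analytic.differentiableAt (Metric.isOpen_ball.mem_nhds ?_)
        rw [mem_ball_zero_iff]
        exact norm_mul_pt_lt (exp_pos _).le
          (by rw [← exp_zero]; exact exp_lt_exp.2 (by linarith [hs.1])) _
      refine ⟨h3.inv (norm_pos_iff.1 (hδ.trans h2)), ?_⟩
      rw [norm_inv]
      exact inv_anti₀ hδ h2.le)
    (by
      refine ae_coe (P := fun t => Tendsto (fun s : ℝ => (Θ.toFun ((rexp (-s) : ℂ) * pt t))⁻¹)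
        (𝓝[>] 0) (𝓝 (conj (Θ.bdry t)))) ?_ _ _ (by linarith)
      -- The limits of 1/Θ are conj(Θ) because |Θ| = 1 almost everywhere.
      filter_upwards [Θ.tendsto_exp_bdry, Θ.conj_bdry_mul_bdry] with t h2 h3
      have h4 : Θ.bdry t ≠ 0 := right_ne_zero_of_mul_eq_one h3
      have h5 := h2.inv₀ h4
      rwa [← eq_inv_of_mul_eq_one_left h3] at h5)
  -- This instance is meant for g, which needs no division by Θ.
  obtain ⟨C₂, h2⟩ := exists_norm_integral_bump_mul_le (B := 1) hd0 hd hs₀ zero_le_one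
    (h := fun _ => 1) (k := fun _ => 1) (fun t ht s hs => by simp)
    (Eventually.of_forall fun t _ => tendsto_const_nhds)
  refine ⟨max C₁ C₂, fun f g hf hg hf' hg' hfg n => ?_⟩
  have hf0 : 0 ≤ ∫ t, ‖f t‖ ∂m := integral_nonneg fun t => norm_nonneg _
  have hfreq : 0 < freq n := by unfold freq; split_ifs <;> omega
  have hle : ∀ C ≤ max C₁ C₂, C * (∫ t, ‖f t‖ ∂m) / (freq n : ℝ) ^ 2 ≤
      max C₁ C₂ * (∫ t, ‖f t‖ ∂m) * (1 / (freq n : ℝ) ^ 2) := by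
    intro C hC
    rw [mul_one_div]
    gcongr
  rcases lt_or_ge n 0 with hn | hn
  · refine le_trans (le_of_eq ?_) ((h1 f hf hf' _ hfreq).trans (hle _ (le_max_left _ _)))
    rw [fourierCoeff]
    congr 1
    refine integral_congr_ae (Eventually.of_forall fun t => ?_)
    have h3 : -n = (freq n : ℤ) := by rw [freq, if_pos hn]; omega
    simp only [smul_eq_mul]
    rw [h3, fourier_natCast]
    ring
  -- Since |f| = |g| almost everywhere, the bound for g is a bound in terms of f.
  · have hng : ∫ t, ‖g t‖ ∂m = ∫ t, ‖f t‖ ∂m := by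
      refine integral_congr_ae ?_
      filter_upwards [hfg, Θ.norm_bdry] with t h3 h4
      rw [h3, norm_mul, Complex.norm_conj, norm_mul, norm_pt, h4, one_mul, one_mul]
    have h4 := h2 g hg hg' _ hfreq
    rw [hng] at h4
    refine le_trans (le_of_eq ?_) (h4.trans (hle _ (le_max_right _ _)))
    rw [fourierCoeff, ← Complex.norm_conj, ← integral_conj]
    congr 1
    refine integral_congr_ae ?_
    filter_upwards [hfg, Θ.conj_bdry_mul_bdry] with t h5 h6
    -- The shift by one is the factor z in conj(z g); it also keeps the frequency positive at n = 0.
    have h3 : (freq n : ℤ) = n + 1 := by rw [freq, if_neg (by omega)]; omega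
    have h7 : pt t ^ freq n = fourier n t * pt t := by
      rw [← fourier_natCast, h3, fourier_add, fourier_one]; rfl
    rw [h7, h5, smul_eq_mul, fourier_neg]
    simp only [map_mul, Complex.conj_conj, conj_bump]
    have h8 : Θ.bdry t * conj (Θ.bdry t) = 1 := by rw [mul_comm]; exact h6
    linear_combination (fourier n t * bump x₀ d t * pt t * g t) * h8

end InnerFunction

/-! ### Compact multiplication operators on model spaces. -/

section Multiplication

variable (p : ℝ≥0∞) [Fact (1 ≤ p)]

/-- Multiplication by bounded functions, as a continuous bilinear map. -/
def mulL : Lp ℂ ∞ m →L[ℂ] Lp ℂ p m →L[ℂ] Lp ℂ p m :=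
  (ContinuousLinearMap.mul ℂ ℂ).holderL m ∞ p p

theorem coeFn_mulL (b : Lp ℂ ∞ m) (f : Lp ℂ p m) :
    (mulL p b f : Torus → ℂ) =ᵐ[m] fun t => (b : Torus → ℂ) t * (f : Torus → ℂ) t :=
  (ContinuousLinearMap.mul ℂ ℂ).coeFn_holder b f

/-- Multiplication by a continuous function on `L^p` of the circle. -/
def mulC : C(Torus, ℂ) →L[ℂ] Lp ℂ p m →L[ℂ] Lp ℂ p m := mulL p ∘L ContinuousMap.toLp ∞ m ℂ

theorem coeFn_mulC (h : C(Torus, ℂ)) (f : Lp ℂ p m) :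
    (mulC p h f : Torus → ℂ) =ᵐ[m] fun t => h t * (f : Torus → ℂ) t := by
  filter_upwards [coeFn_mulL p (ContinuousMap.toLp ∞ m ℂ h) f,
    ContinuousMap.coeFn_toLp (p := ∞) (𝕜 := ℂ) m h] with t h1 h2
  rw [← h2]
  exact h1

theorem integrable_Lp (f : Lp ℂ p m) : Integrable (f : Torus → ℂ) m :=
  (Lp.memLp f).integrable Fact.out

theorem integral_norm_le_norm (f : Lp ℂ p m) : ∫ t, ‖(f : Torus → ℂ) t‖ ∂m ≤ ‖f‖ := by
  rw [integral_norm_eq_lintegral_enorm (Lp.aestronglyMeasurable f),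
    ← eLpNorm_one_eq_lintegral_enorm, Lp.norm_def]
  exact ENNReal.toReal_mono (Lp.eLpNorm_ne_top f)
    (eLpNorm_le_eLpNorm_of_exponent_le Fact.out (Lp.aestronglyMeasurable f))

/-- The Fourier coefficient of index `n`, as a continuous functional on `L^p`. -/
def coeffL (n : ℤ) : Lp ℂ p m →L[ℂ] ℂ :=
  LinearMap.mkContinuous
    { toFun := fun f => fourierCoeff (f : Torus → ℂ) n
      map_add' := fun f g => by
        rw [fourierCoeff_congr_ae (Lp.coeFn_add f g),
          fourierCoeff.add (integrable_Lp p f) (integrable_Lp p g), Pi.add_apply]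
      map_smul' := fun c f => by
        rw [fourierCoeff_congr_ae (Lp.coeFn_smul c f), fourierCoeff.const_smul, RingHom.id_apply] }
    1 fun f => by
      rw [one_mul]
      exact (norm_fourierCoeff_le _ n).trans (integral_norm_le_norm p f)

theorem coeffL_apply (n : ℤ) (f : Lp ℂ p m) : coeffL p n f = fourierCoeff (f : Torus → ℂ) n := rfl

theorem coeffL_fourierLp (k n : ℤ) : coeffL p k (fourierLp p n) = if k = n then 1 else 0 := by
  rw [coeffL_apply, fourierCoeff_congr_ae (coeFn_fourierLp p n), fourierCoeff_fourier,
    Pi.single_apply]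

theorem eq_of_coeffL_eq {f g : Lp ℂ p m} (h : ∀ n, coeffL p n f = coeffL p n g) : f = g := by
  rw [← sub_eq_zero]
  refine Lp.ext ?_
  refine (ae_eq_zero_of_fourierCoeff_eq_zero (integrable_Lp p (f - g)) fun n => ?_).trans
    (Lp.coeFn_zero ℂ p m).symm
  rw [← coeffL_apply, map_sub, h, sub_self]

theorem norm_fourierLp_le (n : ℤ) : ‖fourierLp (T := 2 * π) p n‖ ≤ 1 := by
  refine (Lp.norm_le_of_ae_bound zero_le_one ?_ (f := fourierLp (T := 2 * π) p n)).trans ?_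
  · filter_upwards [coeFn_fourierLp p n] with t ht
    rw [ht, norm_fourier_apply]
  · simp [measureUnivNNReal]

/-- The Fourier series of S x, read as a series of operators of rank at most one, converges
absolutely in operator norm. Its sum is S by uniqueness of Fourier coefficients. -/
theorem isCompactOperator_of_summable_coeff {E : Type*} [NormedAddCommGroup E] [NormedSpace ℂ E]
    (S : E →L[ℂ] Lp ℂ p m) {c : ℤ → ℝ} (hc : Summable c) (hc0 : ∀ n, 0 ≤ c n)
    (h : ∀ x n, ‖coeffL p n (S x)‖ ≤ c n * ‖x‖) : IsCompactOperator S := by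
  set R : ℤ → E →L[ℂ] Lp ℂ p m := fun n => (coeffL p n ∘L S).smulRight (fourierLp p n) with hR
  have hRx : ∀ n x, R n x = coeffL p n (S x) • fourierLp p n := fun n x => rfl
  have hRn : ∀ n, ‖R n‖ ≤ c n := fun n => by
    refine ContinuousLinearMap.opNorm_le_bound _ (hc0 n) fun x => ?_
    rw [hRx, norm_smul]
    exact (mul_le_of_le_one_right (norm_nonneg _) (norm_fourierLp_le p n)).trans (h x n)
  have hsum : HasSum R (∑' n, R n) := (Summable.of_norm_bounded hc hRn).hasSum
  have heq : ∑' n, R n = S := by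
    ext1 x
    have hx : HasSum (fun n => R n x) ((∑' n, R n) x) :=
      hsum.mapL (ContinuousLinearMap.apply ℂ (Lp ℂ p m) x)
    refine eq_of_coeffL_eq p fun k => ?_
    have hk := hx.mapL (coeffL p k)
    refine hk.unique ?_
    simp only [hRx, map_smul, coeffL_fourierLp, smul_eq_mul, mul_ite, mul_one, mul_zero]
    simpa using hasSum_single (f := fun n => if k = n then coeffL p n (S x) else 0) k
      fun n hn => if_neg hn.symm
  rw [heq] at hsum
  refine isCompactOperator_of_tendsto hsum (Eventually.of_forall fun s => ?_)
  have hcomp : ∀ n, R n ∈ compactOperator (RingHom.id ℂ) E (Lp ℂ p m) := by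
    intro n
    have h1 : IsCompactOperator (ContinuousLinearMap.toSpanSingleton ℂ (fourierLp p n) :
        ℂ → Lp ℂ p m) :=
      isCompactOperator_of_locallyCompactSpace_rng _
    exact h1.comp_clm (coeffL p n ∘L S)
  exact Submodule.sum_mem (compactOperator (RingHom.id ℂ) E (Lp ℂ p m)) fun n _ => hcomp n

namespace InnerFunction
variable (Θ : InnerFunction)

theorem isCompactOperator_mulC_bump {x₀ : ℝ} (hx : (x₀ : Torus) ∉ Θ.rho) :
    ∃ ψ : C(Torus, ℂ), ψ x₀ ≠ 0 ∧ IsCompactOperator (mulC p ψ ∘L (Θ.model p).subtypeL) := by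
  obtain ⟨d, hd, C, hC⟩ := Θ.exists_norm_fourierCoeff_bump_mul_le hx
  refine ⟨bump x₀ d, hd, ?_⟩
  have hbdry : MemLp Θ.bdry ∞ m := (memLp_top_const (1 : ℂ)).of_le Θ.aestronglyMeasurable_bdry (by
    filter_upwards [Θ.norm_bdry] with t ht; simp [ht])
  have hS : IsCompactOperator (mulC p (bump x₀ d) ∘L mulL p hbdry.star.toLp ∘L
      (Θ.model p).subtypeL) := by
    refine isCompactOperator_of_summable_coeff p _
      (c := fun n => max C 0 * (1 / (freq n : ℝ) ^ 2)) (summable_inv_freq_sq.mul_left _)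
      (fun n => by positivity) fun f n => ?_
    obtain ⟨hf, g, hg, hfg⟩ := f.2
    have h1 := hC f g (integrable_Lp p _) (integrable_Lp p g) hf hg hfg n
    have h2 : (mulC p (bump x₀ d) (mulL p hbdry.star.toLp (f : Lp ℂ p m)) : Torus → ℂ) =ᵐ[m]
        fun t => bump x₀ d t * (conj (Θ.bdry t) * ((f : Lp ℂ p m) : Torus → ℂ) t) := by
      filter_upwards [coeFn_mulC p (bump x₀ d) (mulL p hbdry.star.toLp (f : Lp ℂ p m)),
        coeFn_mulL p hbdry.star.toLp (f : Lp ℂ p m), hbdry.star.coeFn_toLp] with t h3 h4 h5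
      rw [h3, h4, h5]; rfl
    rw [← fourierCoeff_congr_ae h2] at h1
    refine h1.trans ?_
    rw [mul_right_comm]
    have h6 : ∫ t, ‖((f : Lp ℂ p m) : Torus → ℂ) t‖ ∂m ≤ ‖f‖ := integral_norm_le_norm p (f : Lp ℂ p m)
    have h7 : (0:ℝ) ≤ 1 / (freq n : ℝ) ^ 2 := by positivity
    refine mul_le_mul (mul_le_mul_of_nonneg_right (le_max_left _ _) h7) h6
      (integral_nonneg fun t => norm_nonneg _) (by positivity)
  -- Multiplication by Θ undoes conj(Θ), and composing with a bounded operator preserves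
  -- compactness.
  have h8 : mulC p (bump x₀ d) ∘L (Θ.model p).subtypeL = mulL p hbdry.toLp ∘L
      (mulC p (bump x₀ d) ∘L mulL p hbdry.star.toLp ∘L (Θ.model p).subtypeL) := by
    ext1 f
    refine Lp.ext ?_
    simp only [ContinuousLinearMap.comp_apply, Submodule.subtypeL_apply]
    filter_upwards [coeFn_mulC p (bump x₀ d) (mulL p hbdry.star.toLp (f : Lp ℂ p m)),
      coeFn_mulL p hbdry.star.toLp (f : Lp ℂ p m), hbdry.star.coeFn_toLp, hbdry.coeFn_toLp,
      coeFn_mulL p hbdry.toLp (mulC p (bump x₀ d) (mulL p hbdry.star.toLp (f : Lp ℂ p m))),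
      coeFn_mulC p (bump x₀ d) (f : Lp ℂ p m), Θ.conj_bdry_mul_bdry] with t h1 h2 h3 h4 h5 h6 h7
    rw [h6, h5, h4, h1, h2, h3]
    simp only [Pi.star_apply, RCLike.star_def]
    linear_combination (-(bump x₀ d t * ((f : Lp ℂ p m) : Torus → ℂ) t)) * h7
  rw [h8]
  exact hS.clm_comp (mulL p hbdry.toLp)

/-- The ideal of continuous functions that multiply `K^p_Θ` compactly into `L^p`. -/
def compactIdeal : Ideal C(Torus, ℂ) where
  carrier := {h | IsCompactOperator (mulC p h ∘L (Θ.model p).subtypeL)}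
  zero_mem' := by
    have : mulC p 0 ∘L (Θ.model p).subtypeL = 0 := by rw [map_zero, ContinuousLinearMap.zero_comp]
    rw [Set.mem_ofPred_eq, this]
    exact isCompactOperator_zero
  add_mem' := by
    intro g h hg hh
    rw [Set.mem_ofPred_eq, map_add, ContinuousLinearMap.add_comp]
    exact IsCompactOperator.add hg hh
  smul_mem' := by
    intro g h hh
    have : mulC p (g • h) ∘L (Θ.model p).subtypeL =
        mulC p g ∘L (mulC p h ∘L (Θ.model p).subtypeL) := by
      ext1 f
      refine Lp.ext ?_
      simp only [ContinuousLinearMap.comp_apply, Submodule.subtypeL_apply]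
      filter_upwards [coeFn_mulC p (g • h) (f : Lp ℂ p m), coeFn_mulC p h (f : Lp ℂ p m),
        coeFn_mulC p g (mulC p h (f : Lp ℂ p m))] with t h1 h2 h3
      rw [h1, h3, h2, smul_eq_mul, ContinuousMap.mul_apply, mul_assoc]
    rw [Set.mem_ofPred_eq, this]
    exact IsCompactOperator.clm_comp hh (mulC p g)

/-- The operator depends norm-continuously on the symbol, and compact operators are norm-closed. -/
theorem isClosed_compactIdeal : IsClosed (Θ.compactIdeal p : Set C(Torus, ℂ)) := by
  have h1 : Continuous fun h : C(Torus, ℂ) => mulC p h ∘L (Θ.model p).subtypeL :=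
    (mulC p).continuous.clm_comp continuous_const
  exact (isClosed_setOfPred_isCompactOperator (σ₁₂ := RingHom.id ℂ) (M₁ := Θ.model p)
    (M₂ := Lp ℂ p m)).preimage h1

/-- A closed ideal of C(𝕋) contains every function vanishing on its common zero set, and by the
bumps no point outside ρ(Θ) is a common zero. -/
theorem isCompactOperator_mulC {h : C(Torus, ℂ)} (hh : ∀ t ∈ Θ.rho, h t = 0) :
    IsCompactOperator (mulC p h ∘L (Θ.model p).subtypeL) := by
  have h1 : h ∈ Θ.compactIdeal p := by
    rw [← ContinuousMap.idealOfSet_ofIdeal_isClosed (Θ.isClosed_compactIdeal p),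
      ContinuousMap.mem_idealOfSet]
    intro t ht
    refine hh t ?_
    by_contra htr
    induction t using QuotientAddGroup.induction_on with
    | H x =>
      obtain ⟨ψ, hψ, hψc⟩ := Θ.isCompactOperator_mulC_bump p htr
      exact ht (ContinuousMap.mem_setOfIdeal.2 ⟨ψ, hψc, hψ⟩)
  exact h1

end InnerFunction

end Multiplication

/-! ### Passage from L^p(m) to L^p(|φ| dm). -/

section Embedding

/-- Only this inequality is used: it yields absolute continuity, φ ≠ 0 almost everywhere for the
variation, and the norm bound. -/
theorem variation_withDensityᵥ_le {φ : Torus → ℂ} (hφ : Integrable φ m) :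
    (m.withDensityᵥ φ).variation ≤ m.withDensity fun t => ‖φ t‖ₑ := by
  refine VectorMeasure.variation_le_of_forall_enorm_le fun E hE => ?_
  rw [withDensityᵥ_apply hφ hE, withDensity_apply _ hE]
  exact enorm_integral_le_lintegral_enorm _

variable (p : ℝ≥0∞) (φ : C(Torus, ℂ))

/-- The continuous function `|φ|^{1/p}`. -/
def absRoot : C(Torus, ℂ) where
  toFun t := ((‖φ t‖ ^ (1 / p.toReal) : ℝ) : ℂ)
  continuous_toFun := Complex.continuous_ofReal.comp
    ((map_continuous φ).norm.rpow_const fun _ => Or.inr (by positivity))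

theorem absRoot_apply (t : Torus) : absRoot p φ t = ((‖φ t‖ ^ (1 / p.toReal) : ℝ) : ℂ) := rfl

/-- Equality holds where φ t ≠ 0. At zeros of φ the weight kills the left side, whatever value the
negative power takes there. -/
theorem enorm_mul_enorm_rpow_le (hp0 : 0 < p.toReal) (t : Torus) (z : ℂ) :
    ‖φ t‖ₑ * ‖((‖φ t‖ ^ (-(1 / p.toReal)) : ℝ) : ℂ) * z‖ₑ ^ p.toReal ≤ ‖z‖ₑ ^ p.toReal := by
  rcases eq_or_ne (φ t) 0 with h | h
  · simp [h]
  · have hpos : 0 < ‖φ t‖ := norm_pos_iff.2 h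
    rw [enorm_mul, ENNReal.mul_rpow_of_nonneg _ _ hp0.le, ← mul_assoc]
    refine le_of_eq ?_
    have h1 : ‖((‖φ t‖ ^ (-(1 / p.toReal)) : ℝ) : ℂ)‖ₑ = ‖φ t‖ₑ ^ (-(1 / p.toReal)) := by
      rw [← ofReal_norm, Complex.norm_real, norm_of_nonneg (by positivity),
        ← ENNReal.ofReal_rpow_of_pos hpos, ofReal_norm]
    have h2 : ‖φ t‖ₑ ≠ 0 := by rwa [enorm_ne_zero]
    rw [h1, ← ENNReal.rpow_mul, neg_mul, one_div_mul_cancel hp0.ne', ENNReal.rpow_neg_one,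
      ENNReal.mul_inv_cancel h2 enorm_ne_top, one_mul]

variable {ν : Measure Torus}

theorem eLpNorm_absRoot_inv_mul_le (hp : 1 ≤ p) (hp' : p ≠ ∞)
    (hν : ν ≤ m.withDensity fun t => ‖φ t‖ₑ) (k : Torus → ℂ) :
    eLpNorm (fun t => ((‖φ t‖ ^ (-(1 / p.toReal)) : ℝ) : ℂ) * k t) p ν ≤ eLpNorm k p m := by
  have hp1 : p ≠ 0 := (zero_lt_one.trans_le hp).ne'
  have hp0 : 0 < p.toReal := ENNReal.toReal_pos hp1 hp'
  rw [eLpNorm_eq_lintegral_rpow_enorm_toReal hp1 hp', eLpNorm_eq_lintegral_rpow_enorm_toReal hp1 hp']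
  refine ENNReal.rpow_le_rpow ?_ (by positivity)
  refine (lintegral_mono' hν le_rfl).trans ?_
  refine (lintegral_withDensity_le_lintegral_mul m
    (map_continuous φ).enorm.measurable _).trans ?_
  exact lintegral_mono fun t => enorm_mul_enorm_rpow_le p φ hp0 t (k t)

theorem memLp_absRoot_inv_mul [Fact (1 ≤ p)] (hp' : p ≠ ∞)
    (hν : ν ≤ m.withDensity fun t => ‖φ t‖ₑ) (k : Lp ℂ p m) :
    MemLp (fun t => ((‖φ t‖ ^ (-(1 / p.toReal)) : ℝ) : ℂ) * (k : Torus → ℂ) t) p ν := by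
  have hac : ν ≪ m := (Measure.absolutelyContinuous_of_le hν).trans
    (withDensity_absolutelyContinuous _ _)
  refine ⟨?_, (eLpNorm_absRoot_inv_mul_le p φ Fact.out hp' hν k).trans_lt (Lp.eLpNorm_lt_top k)⟩
  refine AEStronglyMeasurable.mul ?_ ((Lp.aestronglyMeasurable k).mono_ac hac)
  exact (Complex.measurable_ofReal.comp
    ((map_continuous φ).norm.measurable.pow_const _)).aestronglyMeasurable

/-- Multiplication by `|φ|^{-1/p}`, from `L^p` of the circle to `L^p(ν)` with `ν ≤ |φ| dm`. -/
def absRootInvL [Fact (1 ≤ p)] (hp' : p ≠ ∞) (hν : ν ≤ m.withDensity fun t => ‖φ t‖ₑ) :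
    Lp ℂ p m →L[ℂ] Lp ℂ p ν :=
  have hac : ν ≪ m := (Measure.absolutelyContinuous_of_le hν).trans
    (withDensity_absolutelyContinuous _ _)
  LinearMap.mkContinuous
    { toFun := fun k => (memLp_absRoot_inv_mul p φ hp' hν k).toLp
      map_add' := fun k l => by
        rw [← MemLp.toLp_add]
        refine MemLp.toLp_congr _ _ ?_
        filter_upwards [hac (Lp.coeFn_add k l)] with t ht
        simp only [ht, Pi.add_apply, mul_add]
      map_smul' := fun c k => by
        rw [RingHom.id_apply, ← MemLp.toLp_const_smul]
        refine MemLp.toLp_congr _ _ ?_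
        filter_upwards [hac (Lp.coeFn_smul c k)] with t ht
        simp only [ht, Pi.smul_apply, smul_eq_mul]
        ring }
    1 fun k => by
      rw [one_mul]
      simp only [LinearMap.coe_mk, AddHom.coe_mk]
      rw [Lp.norm_toLp, Lp.norm_def]
      exact ENNReal.toReal_mono (Lp.eLpNorm_ne_top k)
        (eLpNorm_absRoot_inv_mul_le p φ Fact.out hp' hν k)

theorem coeFn_absRootInvL [Fact (1 ≤ p)] (hp' : p ≠ ∞)
    (hν : ν ≤ m.withDensity fun t => ‖φ t‖ₑ) (k : Lp ℂ p m) :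
    (absRootInvL p φ hp' hν k : Torus → ℂ) =ᵐ[ν]
      fun t => ((‖φ t‖ ^ (-(1 / p.toReal)) : ℝ) : ℂ) * (k : Torus → ℂ) t :=
  (memLp_absRoot_inv_mul p φ hp' hν k).coeFn_toLp

end Embedding

/-! ### The class V_p(Θ) and the compact extension of A_φ. -/

namespace InnerFunction
variable (Θ : InnerFunction)

/-- Multiplying by |φ|^{1/p} and then by |φ|^{-1/p} gives back f almost everywhere for the
variation. As the variation is absolutely continuous, this one identity yields both requirements on
the embedding. -/
theorem withDensityᵥ_mem_classV (p : ℝ≥0∞) [Fact (1 ≤ p)] (hp' : p ≠ ∞) (φ : C(Torus, ℂ))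
    (hφ : ∀ t ∈ Θ.rho, φ t = 0) : m.withDensityᵥ (φ : Torus → ℂ) ∈ Θ.classV p := by
  have hp0 : 0 < p.toReal := ENNReal.toReal_pos (zero_lt_one.trans_le Fact.out).ne' hp'
  have hν := variation_withDensityᵥ_le (integrable_continuousMap φ)
  have hac : (m.withDensityᵥ (φ : Torus → ℂ)).variation ≪ m :=
    (Measure.absolutelyContinuous_of_le hν).trans (withDensity_absolutelyContinuous _ _)
  have hne : ∀ᵐ t ∂(m.withDensityᵥ (φ : Torus → ℂ)).variation, φ t ≠ 0 := by
    refine (Measure.absolutelyContinuous_of_le hν).ae_le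
      ((ae_withDensity_iff (map_continuous φ).enorm.measurable).2 ?_)
    exact Eventually.of_forall fun t ht => by rwa [enorm_ne_zero] at ht
  set ι : Θ.model p →L[ℂ] Lp ℂ p (m.withDensityᵥ (φ : Torus → ℂ)).variation :=
    absRootInvL p φ hp' hν ∘L (mulC p (absRoot p φ) ∘L (Θ.model p).subtypeL) with hι
  have hιf : ∀ f : Θ.model p, (ι f : Torus → ℂ) =ᵐ[(m.withDensityᵥ (φ : Torus → ℂ)).variation]
      ((f : Lp ℂ p m) : Torus → ℂ) := by
    intro f
    filter_upwards [hne, coeFn_absRootInvL p φ hp' hν (mulC p (absRoot p φ) f),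
      hac (coeFn_mulC p (absRoot p φ) (f : Lp ℂ p m))] with t h1 h2 h3
    have h4 : (ι f : Torus → ℂ) t =
      (absRootInvL p φ hp' hν (mulC p (absRoot p φ) f) : Torus → ℂ) t := rfl
    have hpos : 0 < ‖φ t‖ := norm_pos_iff.2 h1
    rw [h4, h2, h3, absRoot_apply, ← mul_assoc, ← Complex.ofReal_mul,
      ← rpow_add hpos, neg_add_cancel, rpow_zero, Complex.ofReal_one, one_mul]
  refine ⟨ι, ⟨fun f ν' hν' _ => (Measure.absolutelyContinuous_of_le hν').ae_le (hιf f),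
    fun f g hfg => (hιf f).trans (hac hfg)⟩, ?_⟩
  refine (Θ.isCompactOperator_mulC p (h := absRoot p φ) fun t ht => ?_).clm_comp
    (absRootInvL p φ hp' hν)
  -- Finiteness of p matters: 0^{1/p} = 0 needs 1/p ≠ 0.
  simp [absRoot_apply, hφ t ht, zero_rpow (inv_pos.2 hp0).ne']

/-- As φ is bounded, f ↦ P_Θ(φ f) makes sense on all of K_Θ and is the extension. -/
theorem exists_isCompactOperator_truncatedToeplitz (φ : C(Torus, ℂ))
    (hφ : ∀ t ∈ Θ.rho, φ t = 0) : ∃ A : Θ.model 2 →L[ℂ] Θ.model 2,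
      (∀ f : (Θ.truncatedToeplitz (ContinuousMap.toLp 2 m ℂ φ)).domain,
        A f = Θ.truncatedToeplitz (ContinuousMap.toLp 2 m ℂ φ) f) ∧ IsCompactOperator A := by
  refine ⟨Θ.proj ∘L (mulC 2 φ ∘L (Θ.model 2).subtypeL), fun f => ?_,
    (Θ.isCompactOperator_mulC 2 hφ).clm_comp Θ.proj⟩
  change Θ.proj (mulC 2 φ ((f : Θ.model 2) : Lp ℂ 2 m)) =
    Θ.proj (Θ.memLp_mul_modelBdd (ContinuousMap.toLp 2 m ℂ φ) f).toLp
  rfl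

end InnerFunction

/-! ### Density of the bounded elements of K_Θ. -/

theorem pt_eq_fourier (t : Torus) : pt t = fourier 1 t := by
  rw [fourier_one]; rfl

theorem integrable_fourier_mul {u : Torus → ℂ} (hu : Integrable u m) (k : ℤ) :
    Integrable (fun t => fourier k t * u t) m :=
  hu.fourier_smul k

theorem fourierCoeff_fourier_mul (k n : ℤ) (u : Torus → ℂ) :
    fourierCoeff (fun t => fourier k t * u t) n = fourierCoeff u (n - k) := by
  refine integral_congr_ae (Eventually.of_forall fun t => ?_)
  have : -(n - k) = -n + k := by ring
  simp only [this, fourier_add, smul_eq_mul, mul_assoc]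

theorem fourierCoeff_conj (n : ℤ) (u : Torus → ℂ) :
    fourierCoeff (fun t => conj (u t)) n = conj (fourierCoeff u (-n)) := by
  rw [fourierCoeff, fourierCoeff, ← integral_conj]
  refine integral_congr_ae (Eventually.of_forall fun t => ?_)
  simp only [smul_eq_mul, map_mul, fourier_neg, neg_neg]

theorem fourierCoeff_sub_sum {u v : Torus → ℂ} (hu : Integrable u m) (hv : Integrable v m)
    (s : Finset ℕ) (a : ℕ → ℂ) (e : ℕ → ℤ) (n : ℤ) :
    fourierCoeff (fun t => u t - ∑ k ∈ s, a k * (fourier (e k) t * v t)) n =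
      fourierCoeff u n - ∑ k ∈ s, a k * fourierCoeff v (n - e k) := by
  have hi : ∀ k, Integrable (fun t => a k * (fourier (e k) t * v t)) m := fun k =>
    (hv.fourier_smul (e k)).const_mul (a k)
  have h1 : fourierCoeff (fun t => u t - ∑ k ∈ s, a k * (fourier (e k) t * v t)) n =
      fourierCoeff u n + fourierCoeff (∑ k ∈ s, fun t => -a k * (fourier (e k) t * v t)) n := by
    rw [← Pi.add_apply, ← fourierCoeff.add hu (integrable_finsetSum' s fun k _ => by
      simpa using (hi k).neg)]
    congr 1
    funext t
    simp [Finset.sum_apply, sub_eq_add_neg]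
  rw [h1, fourierCoeff.sum s _ (fun k _ => by simpa using (hi k).neg), Finset.sum_apply,
    sub_eq_add_neg, ← Finset.sum_neg_distrib]
  congr 1
  refine Finset.sum_congr rfl fun k _ => ?_
  rw [fourierCoeff.const_mul, fourierCoeff_fourier_mul, neg_mul]

namespace InnerFunction
variable (Θ : InnerFunction)

theorem memLp_bdry (p : ℝ≥0∞) : MemLp Θ.bdry p m := by
  refine (memLp_const (1 : ℂ)).of_le Θ.aestronglyMeasurable_bdry ?_
  filter_upwards [Θ.norm_bdry] with t ht
  simp [ht]

/-- Mean value property for z^N Θ(r z) with N = -n > 0, which vanishes at the origin. -/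
theorem fourierCoeff_dilation {r : ℝ} (hr0 : 0 ≤ r) (hr : r < 1) {n : ℤ} (hn : n < 0) :
    fourierCoeff (fun t => Θ.toFun ((r : ℂ) * pt t)) n = 0 := by
  obtain ⟨N, hN⟩ := Int.eq_ofNat_of_zero_le (show 0 ≤ -n by omega)
  have hN0 : N ≠ 0 := by omega
  set G : ℂ → ℂ := fun z => z ^ N * Θ.toFun (r * z) with hG
  have hd : DiffContOnCl ℂ G (Metric.ball 0 |1|) := by
    refine DifferentiableOn.diffContOnCl fun z hz => ?_
    rw [abs_one, closure_ball _ one_ne_zero, mem_closedBall_zero_iff] at hz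
    have h1 : DifferentiableAt ℂ Θ.toFun (r * z) := by
      refine Θ.analytic.differentiableAt (Metric.isOpen_ball.mem_nhds ?_)
      rw [mem_ball_zero_iff, norm_mul, Complex.norm_real, norm_of_nonneg hr0]
      exact (mul_le_of_le_one_right hr0 hz).trans_lt hr
    have h2 : DifferentiableAt ℂ (fun z : ℂ => Θ.toFun (r * z)) z :=
      DifferentiableAt.comp z h1 (by fun_prop)
    exact ((differentiableAt_id.pow N).mul h2).differentiableWithinAt
  have h1 := hd.circleAverage
  have h2 : G 0 = 0 := by simp [hG, hN0]
  rw [h2, circleAverage_def] at h1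
  rw [fourierCoeff, AddCircle.integral_haarAddCircle,
    ← AddCircle.intervalIntegral_preimage (2 * π) 0, zero_add, ← h1]
  congr 1
  refine intervalIntegral.integral_congr fun x _ => ?_
  simp only [hG, smul_eq_mul]
  rw [hN, fourier_natCast, circleMap_zero, Complex.ofReal_one, one_mul, pt_coe]

theorem fourierCoeff_bdry {n : ℤ} (hn : n < 0) : fourierCoeff Θ.bdry n = 0 := by
  obtain ⟨C, hC⟩ := Θ.bounded
  have h1 : Tendsto (fun r : ℝ => fourierCoeff (fun t => Θ.toFun ((r : ℂ) * pt t)) n) (𝓝[<] 1)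
      (𝓝 (fourierCoeff Θ.bdry n)) := by
    refine tendsto_integral_filter_of_dominated_convergence (fun _ => C) ?_ ?_
      (integrable_const C) ?_
    · filter_upwards [eventually_radius] with r hr
      refine Continuous.aestronglyMeasurable ((map_continuous (fourier (-n))).smul ?_)
      refine Θ.analytic.continuousOn.comp_continuous (continuous_const.mul continuous_pt) fun t => ?_
      rw [mem_ball_zero_iff]
      exact norm_mul_pt_lt hr.1.le hr.2 t
    · filter_upwards [eventually_radius] with r hr
      refine Eventually.of_forall fun t => ?_
      rw [norm_smul, norm_fourier_apply, one_mul]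
      refine hC _ ?_
      rw [mem_ball_zero_iff]
      exact norm_mul_pt_lt hr.1.le hr.2 t
    · filter_upwards [Θ.radial] with t ⟨c, _, h⟩
      rw [bdry, h.limUnder_eq]
      exact h.const_smul _
  refine tendsto_nhds_unique h1 (tendsto_const_nhds.congr' ?_)
  filter_upwards [eventually_radius] with r hr
  exact (Θ.fourierCoeff_dilation hr.1.le hr.2 hn).symm

/-- The projection of the monomial `z^n` to the model space: `z^n - Θ P₊(conj Θ z^n)`. -/
def modelMonomial (n : ℕ) (t : Torus) : ℂ :=
  fourier (n : ℤ) t - ∑ k ∈ Finset.range (n + 1),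
    conj (fourierCoeff Θ.bdry (n - k)) * (fourier (k : ℤ) t * Θ.bdry t)

theorem memLp_modelMonomial (n : ℕ) (p : ℝ≥0∞) : MemLp (Θ.modelMonomial n) p m := by
  have h1 : ∀ k : ℤ, MemLp (fun t : Torus => (fourier k t : ℂ)) p m := fun k =>
    (memLp_const (1 : ℂ)).of_le (map_continuous (fourier k)).aestronglyMeasurable
      (Eventually.of_forall fun t => by rw [norm_fourier_apply, norm_one])
  refine (h1 n).sub (memLp_finsetSum _ fun k _ => MemLp.const_mul ?_ _)
  exact memLp_mul_of_norm_le (map_continuous (fourier (k : ℤ))).aestronglyMeasurable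
    (Eventually.of_forall fun t => (norm_fourier_apply _ _).le) (Θ.memLp_bdry p)

/-- The coefficient of conj(Θ) z^n at k is the conjugate of that of Θ at n - k, which is zero for k
> n. Hence subtracting the finitely many indices 0, …, n removes the whole nonnegative part. -/
theorem fourierCoeff_conj_bdry_mul_modelMonomial (n : ℕ) {j : ℤ} (hj : 0 ≤ j) :
    fourierCoeff (fun t => conj (Θ.bdry t) * Θ.modelMonomial n t) j = 0 := by
  have h1 : (fun t => conj (Θ.bdry t) * Θ.modelMonomial n t) =ᵐ[m]
      fun t => fourier (n : ℤ) t * conj (Θ.bdry t) - ∑ k ∈ Finset.range (n + 1),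
        conj (fourierCoeff Θ.bdry (n - k)) * (fourier (k : ℤ) t * fourier 0 t) := by
    filter_upwards [Θ.conj_bdry_mul_bdry] with t ht
    rw [modelMonomial, mul_sub, Finset.mul_sum, mul_comm (conj _)]
    congr 1
    refine Finset.sum_congr rfl fun k _ => ?_
    rw [fourier_zero]
    linear_combination (conj (fourierCoeff Θ.bdry (n - k)) * fourier (k : ℤ) t) * ht
  have hi : Integrable (fun t => conj (Θ.bdry t)) m :=
    (memLp_one_iff_integrable.1 (Θ.memLp_bdry 1).star)
  rw [fourierCoeff_congr_ae h1, fourierCoeff_sub_sum (integrable_fourier_mul hi n)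
    (integrable_continuousMap (fourier 0)), fourierCoeff_fourier_mul, fourierCoeff_conj,
    fourierCoeff_fourier]
  obtain ⟨i, rfl⟩ := Int.eq_ofNat_of_zero_le hj
  simp only [Pi.single_apply, sub_eq_zero, Nat.cast_inj, mul_ite, mul_one, mul_zero,
    Finset.sum_ite_eq, Finset.mem_range, neg_sub]
  split_ifs with h
  · rfl
  · rw [Θ.fourierCoeff_bdry (by omega), map_zero]

theorem modelMonomial_mem_model (n : ℕ) : (Θ.memLp_modelMonomial n 2).toLp ∈ Θ.model 2 := by
  have hgm : MemLp (fun t => (conj (pt t) * Θ.bdry t) * conj (Θ.modelMonomial n t)) 2 m := by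
    refine memLp_mul_of_norm_le ?_ ?_ (Θ.memLp_modelMonomial n 2).star
    · exact ((Complex.continuous_conj.comp continuous_pt).aestronglyMeasurable).mul
        Θ.aestronglyMeasurable_bdry
    · filter_upwards [Θ.norm_bdry] with t ht
      simp [ht, norm_pt]
  refine ⟨fun j hj => ?_, hgm.toLp, fun j hj => ?_, ?_⟩
  · rw [fourierCoeff_congr_ae (Θ.memLp_modelMonomial n 2).coeFn_toLp]
    unfold modelMonomial
    rw [fourierCoeff_sub_sum (integrable_continuousMap (fourier (n : ℤ)))
      (memLp_one_iff_integrable.1 (Θ.memLp_bdry 1)), fourierCoeff_fourier,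
      Pi.single_eq_of_ne (by omega), zero_sub, neg_eq_zero]
    refine Finset.sum_eq_zero fun k _ => ?_
    rw [Θ.fourierCoeff_bdry (show j - k < 0 by omega), mul_zero]
  · rw [fourierCoeff_congr_ae hgm.coeFn_toLp]
    have h1 : (fun t => (conj (pt t) * Θ.bdry t) * conj (Θ.modelMonomial n t)) =
        fun t => fourier (-1) t * conj (conj (Θ.bdry t) * Θ.modelMonomial n t) := by
      funext t
      rw [pt_eq_fourier, fourier_neg, map_mul, Complex.conj_conj, mul_assoc]
    rw [h1, fourierCoeff_fourier_mul, fourierCoeff_conj,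
      Θ.fourierCoeff_conj_bdry_mul_modelMonomial n (by omega), map_zero]
  · filter_upwards [hgm.coeFn_toLp, (Θ.memLp_modelMonomial n 2).coeFn_toLp,
      Θ.conj_bdry_mul_bdry] with t h1 h2 h3
    have h4 : pt t * conj (pt t) = 1 := by
      rw [Complex.mul_conj, Complex.normSq_eq_norm_sq, norm_pt]; simp
    rw [h1, h2]
    simp only [map_mul, Complex.conj_conj]
    linear_combination (-(Θ.modelMonomial n t)) * (pt t * conj (pt t) * h3 + h4)

/-- The subtracted terms are orthogonal to K_Θ: pairing Θ z^k with f = Θ conj(z g) gives the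
conjugate of the coefficient of g at -k - 1, which is zero. -/
theorem inner_modelMonomial (n : ℕ) {f : Lp ℂ 2 m} (hf : f ∈ Θ.model 2) :
    ⟪(Θ.memLp_modelMonomial n 2).toLp, f⟫_ℂ = fourierCoeff (f : Torus → ℂ) n := by
  obtain ⟨-, g, hg, hfg⟩ := hf
  have hgi : Integrable (fun t => conj (fourier 1 t * (g : Torus → ℂ) t)) m := by
    have := integrable_fourier_mul (integrable_Lp 2 g) 1
    exact memLp_one_iff_integrable.1 (memLp_one_iff_integrable.2 this).star
  have h0 : ∀ u : Torus → ℂ, fourierCoeff u 0 = ∫ t, u t ∂m := fun u => by simp [fourierCoeff]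
  have h1 : ⟪(Θ.memLp_modelMonomial n 2).toLp, f⟫_ℂ = fourierCoeff (fun t =>
      fourier (-n : ℤ) t * (f : Torus → ℂ) t - ∑ k ∈ Finset.range (n + 1),
        fourierCoeff Θ.bdry (n - k) *
          (fourier (-k : ℤ) t * conj (fourier 1 t * (g : Torus → ℂ) t))) 0 := by
    rw [h0, L2.inner_def]
    refine integral_congr_ae ?_
    filter_upwards [hfg, (Θ.memLp_modelMonomial n 2).coeFn_toLp, Θ.conj_bdry_mul_bdry]
      with t h2 h3 h4
    rw [RCLike.inner_apply, h3, modelMonomial, map_sub, map_sum, mul_sub, Finset.mul_sum, mul_comm,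
      fourier_neg]
    congr 1
    refine Finset.sum_congr rfl fun k _ => ?_
    rw [h2, pt_eq_fourier, fourier_neg]
    simp only [map_mul, Complex.conj_conj]
    linear_combination (fourierCoeff Θ.bdry (n - k) * conj (fourier (k : ℤ) t) *
      (conj (fourier 1 t) * conj ((g : Torus → ℂ) t))) * h4
  rw [h1, fourierCoeff_sub_sum (integrable_fourier_mul (integrable_Lp 2 f) _) hgi, fourierCoeff_fourier_mul,
    Finset.sum_eq_zero, sub_zero, zero_sub, neg_neg]
  intro k _
  rw [fourierCoeff_conj, fourierCoeff_fourier_mul, hg _ (by omega), map_zero, mul_zero]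

/-- An element orthogonal to all bounded ones is orthogonal to the projected monomials, so its
coefficients of nonnegative index vanish too. -/
theorem dense_modelBdd : Dense (Θ.modelBdd : Set (Θ.model 2)) := by
  rw [Submodule.dense_iff_topologicalClosure_eq_top, Submodule.topologicalClosure_eq_top_iff,
    Submodule.eq_bot_iff]
  intro f hf
  refine Subtype.ext (eq_of_coeffL_eq 2 fun n => ?_)
  rw [Submodule.coe_zero, map_zero, coeffL_apply]
  rcases lt_or_ge n 0 with hn | hn
  · exact f.2.1 n hn
  · obtain ⟨N, rfl⟩ := Int.eq_ofNat_of_zero_le hn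
    rw [← Θ.inner_modelMonomial N f.2]
    exact hf ⟨_, Θ.modelMonomial_mem_model N⟩
      ((Θ.memLp_modelMonomial N ∞).ae_eq (Θ.memLp_modelMonomial N 2).coeFn_toLp.symm)

end InnerFunction
end TTO

end

theorem mainTheorem7 (Θ : TTO.InnerFunction) (φ : C(TTO.Torus, ℂ))
    (hφ : ∀ t ∈ Θ.rho, φ t = 0) :
    (∀ (p : ℝ≥0∞) [Fact (1 ≤ p)], p ≠ ∞ → TTO.m.withDensityᵥ (φ : TTO.Torus → ℂ) ∈ Θ.classV p) ∧
    (Dense ((Θ.truncatedToeplitz (ContinuousMap.toLp 2 TTO.m ℂ φ)).domain : Set (Θ.model 2)) ∧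
      ∃ A : Θ.model 2 →L[ℂ] Θ.model 2,
        (∀ f : (Θ.truncatedToeplitz (ContinuousMap.toLp 2 TTO.m ℂ φ)).domain,
          A f = Θ.truncatedToeplitz (ContinuousMap.toLp 2 TTO.m ℂ φ) f) ∧
        IsCompactOperator A) :=
  ⟨fun p _ hp => Θ.withDensityᵥ_mem_classV p hp φ hφ, Θ.dense_modelBdd,
    Θ.exists_isCompactOperator_truncatedToeplitz φ hφ⟩
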